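/- Let $r,s,t,u$ be integers with $rstu\neq 0$ and $ru-st=\pm1$, and let \[ G=\langle a_1,b_1,a_2 \mid a_1b_1a_1^{-1}=b_1^{-1},\ a_2^2=a_1^{2r}b_1^{s},\ a_2a_1^{2t}b_1^{u}a_2^{-1}=b_1^{-u}a_1^{-2t}\rangle \] (this is the fundamental group of the torus semi-bundle, or sapphire, $K(r,s,t,u)$). Let $p$ be an odd prime and let $\mathbb{Z}_p=\mathbb{Z}/p\mathbb{Z}$ be the trivial $G$-module. Then the group cohomology of $G$ is given by \[ H^0(G;\mathbb{Z}_p)\cong\mathbb{Z}_p,\qquad H^3(G;\mathbb{Z}_p)\cong\mathbb{Z}_p,\qquad H^n(G;\mathbb{Z}_p)=0\ \text{ for } n\geq 4, \] \[ H^1(G;\mathbb{Z}_p)\cong H^2(G;\mathbb{Z}_p)\cong\begin{cases}\mathbb{Z}_p,&\text{if } p\mid t,\\ 0,&\text{if } p\nmid t.\end{cases} \] Moreover, if $p\mid t$, there are a generator $\alpha$ of $H^1(G;\mathbb{Z}_p)$ and a generator $\beta$ of $H^2(G;\mathbb{Z}_p)$ such that $\alpha\smile\beta$ generates $H^3(G;\mathbb{Z}_p)$,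 and such that there is an isomorphism of $\mathbb{Z}_p$-algebras \[ H^*(G;\mathbb{Z}_p)=\bigoplus_{n\ge 0}H^n(G;\mathbb{Z}_p)\ \cong\ \frac{\mathbb{Z}_p[\alpha,\beta]}{(\alpha^2,\beta^2)},\qquad \dim(\alpha)=1,\ \dim(\beta)=2, \] where $H^*(G;\mathbb{Z}_p)$ carries the cup product and the isomorphism sends the classes $\alpha,\beta$ to the classes of the variables $\alpha,\beta$. -/

import Mathlib

noncomputable section

open CategoryTheory groupCohomology

set_option linter.unusedSectionVars false

namespace GroupCohomologyRing

universe u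

variable {k G : Type u} [CommRing k] [Group G]

/-! ### Inhomogeneous cochains and their cup product -/

/-- Inhomogeneous `n`-cochains of `G` with values in the trivial module `k`. -/
abbrev Cochain (k G : Type u) (n : ℕ) : Type u := (Fin n → G) → k

/-- The coboundary of inhomogeneous cochains, as defined in Mathlib. -/
abbrev cobd {n : ℕ} (f : Cochain k G n) : Cochain k G (n + 1) :=
  (inhomogeneousCochains.d (Rep.trivial k G k) n).hom f

/-- The cup product of cochains,
`(f ⌣ h) (g₁, …, gₘ₊ₙ) = f (g₁, …, gₘ) * h (gₘ₊₁, …, gₘ₊ₙ)`. -/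
def cochainCup {m n : ℕ} (f : Cochain k G m) (h : Cochain k G n) : Cochain k G (m + n) :=
  fun g => f (fun i => g (Fin.castAdd n i)) * h (fun j => g (Fin.natAdd m j))

/-- Evaluation of an `n`-cochain on the first `n` terms of a sequence. -/
def ev {n : ℕ} (f : Cochain k G n) (g : ℕ → G) : k := f (fun i => g i)

theorem ev_ext {n : ℕ} {f h : Cochain k G n} (H : ∀ g : ℕ → G, ev f g = ev h g) : f = h := by
  funext g
  have := H (fun i => if hi : i < n then g ⟨i, hi⟩ else 1)
  simpa [ev] using this

/-- Multiplication of the `j`-th and `(j+1)`-st terms of a sequence. -/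
def contr (j : ℕ) (g : ℕ → G) : ℕ → G :=
  fun i => if i < j then g i else if i = j then g i * g (i + 1) else g (i + 1)

theorem ev_cobd {n : ℕ} (f : Cochain k G n) (g : ℕ → G) :
    ev (cobd f) g = ev f (fun i => g (i + 1)) +
      ∑ j ∈ Finset.range (n + 1), (-1 : k) ^ (j + 1) * ev f (contr j g) := by
  have := inhomogeneousCochains.d_hom_apply (Rep.trivial k G k) n f (fun i => g i)
  rw [← Fin.sum_univ_eq_sum_range (fun j => (-1 : k) ^ (j + 1) * ev f (contr j g))]
  exact this

theorem ev_cochainCup {m n : ℕ} (f : Cochain k G m) (h : Cochain k G n) (g : ℕ → G) :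
    ev (cochainCup f h) g = ev f g * ev h (fun i => g (m + i)) := rfl

theorem ev_congr {n : ℕ} (f : Cochain k G n) {g g' : ℕ → G} (H : ∀ i < n, g i = g' i) :
    ev f g = ev f g' := by
  unfold ev
  congr 1
  funext i
  exact H i i.2

/-- The Leibniz rule. -/
theorem ev_cobd_cochainCup {m n : ℕ} (f : Cochain k G m) (h : Cochain k G n) (g : ℕ → G) :
    ev (cobd (cochainCup f h)) g =
      ev (cochainCup (cobd f) h) g + (-1) ^ m * ev (cochainCup f (cobd h)) g := by
  simp only [ev_cobd, ev_cochainCup]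
  rw [add_assoc m n 1, Finset.sum_range_add]
  have e1 : ∀ j ∈ Finset.range m,
      (-1 : k) ^ (j + 1) * (ev f (contr j g) * ev h (fun i => contr j g (m + i))) =
        (-1 : k) ^ (j + 1) * ev f (contr j g) * ev h (fun i => g (m + 1 + i)) := by
    intro j hj
    rw [Finset.mem_range] at hj
    rw [mul_assoc]
    congr 2
    apply ev_congr
    intro i _
    simp only [contr]
    rw [if_neg (by omega), if_neg (by omega)]
    congr 1
    omega
  have e2 : ∀ j ∈ Finset.range (n + 1),
      (-1 : k) ^ (m + j + 1) * (ev f (contr (m + j) g) * ev h (fun i => contr (m + j) g (m + i))) =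
        (-1) ^ m * ev f g * ((-1 : k) ^ (j + 1) * ev h (contr j (fun i => g (m + i)))) := by
    intro j _
    have h1 : ev f (contr (m + j) g) = ev f g := by
      apply ev_congr
      intro i hi
      simp only [contr]
      rw [if_pos (by omega)]
    have h2 : (fun i => contr (m + j) g (m + i)) = contr j (fun i => g (m + i)) := by
      funext i
      simp only [contr, add_lt_add_iff_left, add_right_inj, add_assoc]
    rw [h1, h2]
    ring
  rw [Finset.sum_congr rfl e1, Finset.sum_congr rfl e2, ← Finset.sum_mul, ← Finset.mul_sum,
    Finset.sum_range_succ _ m]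
  have h3 : ev f (contr m g) = ev f g := by
    apply ev_congr
    intro i hi
    simp only [contr]
    rw [if_pos hi]
  have h4 : (fun i => g (m + i + 1)) = fun i => g (m + 1 + i) := by
    funext i
    congr 1
    omega
  have h5 : (fun i => g (m + (i + 1))) = fun i => g (m + 1 + i) := by
    funext i
    congr 1
    omega
  rw [h3, h4, h5]
  ring

theorem ev_cochainCup_zero_left {m n : ℕ} (h : Cochain k G n) (g : ℕ → G) :
    ev (cochainCup (0 : Cochain k G m) h) g = 0 := zero_mul _

theorem ev_cochainCup_zero_right {m n : ℕ} (f : Cochain k G m) (g : ℕ → G) :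
    ev (cochainCup f (0 : Cochain k G n)) g = 0 := mul_zero _

theorem cobd_cochainCup_eq_zero {m n : ℕ} {f : Cochain k G m} {h : Cochain k G n}
    (hf : cobd f = 0) (hh : cobd h = 0) : cobd (cochainCup f h) = 0 := by
  apply ev_ext
  intro g
  rw [ev_cobd_cochainCup, hf, hh, ev_cochainCup_zero_left, ev_cochainCup_zero_right]
  simp [ev]

/-! ### Cohomology classes -/

/-- `Hⁿ(G; k)`: Mathlib's group cohomology with coefficients in the trivial module `k`. -/
abbrev H (k G : Type u) [CommRing k] [Group G] (n : ℕ) : Type u :=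
  groupCohomology (Rep.trivial k G k) n

/-- The cohomology class of a cocycle. -/
def cls {n : ℕ} (f : Cochain k G n) (hf : cobd f = 0) : H k G n :=
  (groupCohomology.π (Rep.trivial k G k) n).hom
    (cocyclesMk (A := Rep.trivial k G k) f hf)

theorem exists_cls {n : ℕ} (x : H k G n) :
    ∃ (f : Cochain k G n) (hf : cobd f = 0), cls f hf = x := by
  induction x using groupCohomology_induction_on with
  | h z =>
    have hz : cobd (k := k) (G := G) ((iCocycles (Rep.trivial k G k) n).hom z) = 0 := by
      have h1 := (inhomogeneousCochains (Rep.trivial k G k)).iCycles_d n (n + 1)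
      rw [inhomogeneousCochains.d_def] at h1
      exact congrArg (fun φ => φ.hom z) h1
    refine ⟨_, hz, ?_⟩
    unfold cls
    congr 1
    apply (ModuleCat.mono_iff_injective (iCocycles (Rep.trivial k G k) n)).1 inferInstance
    exact iCocycles_mk (A := Rep.trivial k G k) _ hz

theorem cls_add {n : ℕ} (f h : Cochain k G n) (hf : cobd f = 0) (hh : cobd h = 0)
    (hfh : cobd (f + h) = 0) : cls (f + h) hfh = cls f hf + cls h hh := by
  unfold cls
  rw [← map_add]
  congr 1
  apply (ModuleCat.mono_iff_injective (iCocycles (Rep.trivial k G k) n)).1 inferInstance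
  rw [map_add]
  erw [iCocycles_mk, iCocycles_mk, iCocycles_mk]

theorem cls_smul {n : ℕ} (a : k) (f : Cochain k G n) (hf : cobd f = 0)
    (haf : cobd (a • f) = 0) : cls (a • f) haf = a • cls f hf := by
  unfold cls
  rw [← map_smul]
  congr 1
  apply (ModuleCat.mono_iff_injective (iCocycles (Rep.trivial k G k) n)).1 inferInstance
  rw [map_smul]
  erw [iCocycles_mk, iCocycles_mk]

theorem cobd_add {n : ℕ} {f h : Cochain k G n} (hf : cobd f = 0) (hh : cobd h = 0) :
    cobd (f + h) = 0 := by
  have := map_add (inhomogeneousCochains.d (Rep.trivial k G k) n).hom f h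
  exact this.trans ((congrArg₂ (· + ·) hf hh).trans (add_zero _))

theorem cobd_smul {n : ℕ} (a : k) {f : Cochain k G n} (hf : cobd f = 0) :
    cobd (a • f) = 0 := by
  have := map_smul (inhomogeneousCochains.d (Rep.trivial k G k) n).hom a f
  exact this.trans ((congrArg (a • ·) hf).trans (smul_zero _))

theorem cobd_cobd {n : ℕ} (f : Cochain k G n) : cobd (cobd f) = 0 :=
  congrArg (fun φ => φ.hom f) (inhomogeneousCochains.d_comp_d n (Rep.trivial k G k))

/-- A cocycle has trivial class if and only if it is zero or the coboundary of a cochain of degree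
one less. -/
theorem cls_eq_zero_iff {n : ℕ} (f : Cochain k G n) (hf : cobd f = 0) :
    cls f hf = 0 ↔ f = 0 ∨
      ∃ (i : ℕ) (φ : Cochain k G i), i + 1 = n ∧ ∀ g : ℕ → G, ev f g = ev (cobd φ) g := by
  have key : ∀ i, (ComplexShape.up ℕ).prev n = i →
      (cls f hf = 0 ↔ ∃ φ : (inhomogeneousCochains (Rep.trivial k G k)).X i,
        ((inhomogeneousCochains (Rep.trivial k G k)).d i n).hom φ = f) := by
    intro i hi
    let K := inhomogeneousCochains (Rep.trivial k G k)
    have ex : (ShortComplex.mk (K.toCycles i n) (K.homologyπ n) (by simp)).Exact :=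
      ShortComplex.exact_of_g_is_cokernel _ (K.homologyIsCokernel i n hi)
    have ex' := (ShortComplex.moduleCat_exact_iff _).1 ex
    constructor
    · intro h0
      obtain ⟨φ, hφ⟩ := ex' _ h0
      refine ⟨φ, ?_⟩
      have h1 := congrArg (iCocycles (Rep.trivial k G k) n).hom hφ
      rw [← K.toCycles_i i n]
      exact h1.trans (iCocycles_mk (A := Rep.trivial k G k) f hf)
    · rintro ⟨φ, hφ⟩
      have h2 : (K.toCycles i n).hom φ = cocyclesMk (A := Rep.trivial k G k) f hf := by
        apply (ModuleCat.mono_iff_injective (iCocycles (Rep.trivial k G k) n)).1 inferInstance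
        refine Eq.trans ?_ (iCocycles_mk (A := Rep.trivial k G k) f hf).symm
        rw [← hφ, ← K.toCycles_i i n]
        rfl
      unfold cls
      rw [← h2]
      have h3 : K.toCycles i n ≫ K.homologyπ n = 0 := by simp
      exact congrArg (fun ψ => ψ.hom φ) h3
  cases n with
  | zero =>
    rw [key 0 (by simp)]
    have h0 : (inhomogeneousCochains (Rep.trivial k G k)).d 0 0 = 0 :=
      HomologicalComplex.shape _ _ _ (by simp)
    rw [h0]
    constructor
    · rintro ⟨φ, hφ⟩
      exact Or.inl hφ.symm
    · rintro (h | ⟨i, _, hi, _⟩)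
      · exact ⟨0, h.symm⟩
      · omega
  | succ m =>
    rw [key m (by simp), inhomogeneousCochains.d_def]
    constructor
    · rintro ⟨φ, hφ⟩
      refine Or.inr ⟨m, φ, rfl, fun g => ?_⟩
      rw [← hφ]
    · rintro (h | ⟨i, φ, hi, h⟩)
      · exact ⟨0, by rw [h]; exact map_zero _⟩
      · obtain rfl : i = m := by omega
        exact ⟨φ, (ev_ext h).symm⟩

theorem cls_congr {n : ℕ} {f h : Cochain k G n} (e : f = h) (hf : cobd f = 0)
    (hh : cobd h = 0) : cls f hf = cls h hh := by
  subst e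
  rfl

theorem mk_cls_eq {m n : ℕ} {f : Cochain k G m} {h : Cochain k G n} (e : m = n)
    (E : ∀ g : ℕ → G, ev f g = ev h g) (hf : cobd f = 0) (hh : cobd h = 0) :
    GradedMonoid.mk (A := H k G) m (cls f hf) = GradedMonoid.mk (A := H k G) n (cls h hh) := by
  subst e
  obtain rfl := ev_ext E
  rfl

/-! ### The cup product in cohomology -/

/-- The cup product `Hᵐ(G; k) × Hⁿ(G; k) → Hᵐ⁺ⁿ(G; k)`, i.e. the class of the cup product of
representing cocycles; see `cup_cls` for the independence of the choice of cocycles. -/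
def cup {m n : ℕ} (x : H k G m) (y : H k G n) : H k G (m + n) :=
  cls (cochainCup (exists_cls x).choose (exists_cls y).choose)
    (cobd_cochainCup_eq_zero (exists_cls x).choose_spec.choose (exists_cls y).choose_spec.choose)

theorem sub_eq_zero_or {n : ℕ} {f f' : Cochain k G n} {hf : cobd f = 0} {hf' : cobd f' = 0}
    (e : cls f hf = cls f' hf') :
    ∃ z : Cochain k G n, ∃ hz : cobd z = 0, f = f' + z ∧ cls z hz = 0 := by
  have h1 : cobd ((-1 : k) • f') = 0 := cobd_smul _ hf'
  refine ⟨f + (-1 : k) • f', cobd_add hf h1, ?_, ?_⟩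
  · simp
  · rw [cls_add f _ hf h1, cls_smul _ f' hf', e]
    simp

theorem cochainCup_add_left {m n : ℕ} (f f' : Cochain k G m) (h : Cochain k G n) :
    cochainCup (f + f') h = cochainCup f h + cochainCup f' h :=
  funext fun _ => add_mul _ _ _

theorem cochainCup_add_right {m n : ℕ} (f : Cochain k G m) (h h' : Cochain k G n) :
    cochainCup f (h + h') = cochainCup f h + cochainCup f h' :=
  funext fun _ => mul_add _ _ _

theorem cochainCup_smul_left {m n : ℕ} (a : k) (f : Cochain k G m) (h : Cochain k G n) :
    cochainCup (a • f) h = a • cochainCup f h :=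
  funext fun _ => mul_assoc _ _ _

theorem cochainCup_smul_right {m n : ℕ} (a : k) (f : Cochain k G m) (h : Cochain k G n) :
    cochainCup f (a • h) = a • cochainCup f h :=
  funext fun _ => mul_left_comm _ _ _

theorem cls_cochainCup_zero_left {m n : ℕ} {z : Cochain k G m} {h : Cochain k G n}
    (hz : cobd z = 0) (hh : cobd h = 0) (z0 : cls z hz = 0) :
    cls (cochainCup z h) (cobd_cochainCup_eq_zero hz hh) = 0 := by
  rw [cls_eq_zero_iff] at z0 ⊢
  rcases z0 with rfl | ⟨i, φ, hi, hφ⟩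
  · exact Or.inl (funext fun _ => zero_mul _)
  · refine Or.inr ⟨i + n, cochainCup φ h, by omega, fun g => ?_⟩
    rw [ev_cobd_cochainCup, hh, ev_cochainCup_zero_right, mul_zero, add_zero]
    subst hi
    rw [ev_cochainCup, ev_cochainCup, hφ]

theorem cls_cochainCup_zero_right {m n : ℕ} {f : Cochain k G m} {z : Cochain k G n}
    (hf : cobd f = 0) (hz : cobd z = 0) (z0 : cls z hz = 0) :
    cls (cochainCup f z) (cobd_cochainCup_eq_zero hf hz) = 0 := by
  rw [cls_eq_zero_iff] at z0 ⊢
  rcases z0 with rfl | ⟨i, φ, hi, hφ⟩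
  · exact Or.inl (funext fun _ => mul_zero _)
  · refine Or.inr ⟨m + i, (-1 : k) ^ m • cochainCup f φ, by omega, fun g => ?_⟩
    have h1 : cobd ((-1 : k) ^ m • cochainCup f φ) = (-1 : k) ^ m • cobd (cochainCup f φ) :=
      map_smul (inhomogeneousCochains.d (Rep.trivial k G k) (m + i)).hom _ _
    rw [h1]
    change _ = (-1 : k) ^ m * ev (cobd (cochainCup f φ)) g
    rw [ev_cobd_cochainCup, hf, ev_cochainCup_zero_left, zero_add, ← mul_assoc, ← mul_pow]
    subst hi
    rw [ev_cochainCup, ev_cochainCup, hφ]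
    simp

/-- The cup product of classes of cocycles is the class of the cup product of the cocycles. -/
theorem cup_cls {m n : ℕ} (f : Cochain k G m) (h : Cochain k G n) (hf : cobd f = 0)
    (hh : cobd h = 0) :
    cup (cls f hf) (cls h hh) = cls (cochainCup f h) (cobd_cochainCup_eq_zero hf hh) := by
  have wd : ∀ (f' : Cochain k G m) (h' : Cochain k G n) (hf' : cobd f' = 0) (hh' : cobd h' = 0),
      cls f' hf' = cls f hf → cls h' hh' = cls h hh →
      cls (cochainCup f' h') (cobd_cochainCup_eq_zero hf' hh') =
        cls (cochainCup f h) (cobd_cochainCup_eq_zero hf hh) := by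
    intro f' h' hf' hh' ef eh
    obtain ⟨z, hz, rfl, z0⟩ := sub_eq_zero_or ef
    obtain ⟨w, hw, rfl, w0⟩ := sub_eq_zero_or eh
    rw [cls_congr (cochainCup_add_left f z (h + w)) _
        (cobd_add (cobd_cochainCup_eq_zero hf hh') (cobd_cochainCup_eq_zero hz hh')),
      cls_add _ _ (cobd_cochainCup_eq_zero hf hh') (cobd_cochainCup_eq_zero hz hh'),
      cls_cochainCup_zero_left hz hh' z0, add_zero,
      cls_congr (cochainCup_add_right f h w) _
        (cobd_add (cobd_cochainCup_eq_zero hf hh) (cobd_cochainCup_eq_zero hf hw)),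
      cls_add _ _ (cobd_cochainCup_eq_zero hf hh) (cobd_cochainCup_eq_zero hf hw),
      cls_cochainCup_zero_right hf hw w0, add_zero]
  exact wd _ _ _ _ (exists_cls (cls f hf)).choose_spec.choose_spec
    (exists_cls (cls h hh)).choose_spec.choose_spec

theorem cup_add_left {m n : ℕ} (x x' : H k G m) (y : H k G n) :
    cup (x + x') y = cup x y + cup x' y := by
  obtain ⟨f, hf, rfl⟩ := exists_cls x
  obtain ⟨f', hf', rfl⟩ := exists_cls x'
  obtain ⟨h, hh, rfl⟩ := exists_cls y
  rw [← cls_add f f' hf hf' (cobd_add hf hf'), cup_cls, cup_cls, cup_cls,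
    ← cls_add _ _ _ _ (cobd_add (cobd_cochainCup_eq_zero hf hh) (cobd_cochainCup_eq_zero hf' hh))]
  exact cls_congr (cochainCup_add_left f f' h) _ _

theorem cup_add_right {m n : ℕ} (x : H k G m) (y y' : H k G n) :
    cup x (y + y') = cup x y + cup x y' := by
  obtain ⟨f, hf, rfl⟩ := exists_cls x
  obtain ⟨h, hh, rfl⟩ := exists_cls y
  obtain ⟨h', hh', rfl⟩ := exists_cls y'
  rw [← cls_add h h' hh hh' (cobd_add hh hh'), cup_cls, cup_cls, cup_cls,
    ← cls_add _ _ _ _ (cobd_add (cobd_cochainCup_eq_zero hf hh) (cobd_cochainCup_eq_zero hf hh'))]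
  exact cls_congr (cochainCup_add_right f h h') _ _

theorem cup_smul_left {m n : ℕ} (a : k) (x : H k G m) (y : H k G n) :
    cup (a • x) y = a • cup x y := by
  obtain ⟨f, hf, rfl⟩ := exists_cls x
  obtain ⟨h, hh, rfl⟩ := exists_cls y
  rw [← cls_smul a f hf (cobd_smul a hf), cup_cls, cup_cls,
    ← cls_smul a _ _ (cobd_smul a (cobd_cochainCup_eq_zero hf hh))]
  exact cls_congr (cochainCup_smul_left a f h) _ _

theorem cup_smul_right {m n : ℕ} (a : k) (x : H k G m) (y : H k G n) :
    cup x (a • y) = a • cup x y := by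
  obtain ⟨f, hf, rfl⟩ := exists_cls x
  obtain ⟨h, hh, rfl⟩ := exists_cls y
  rw [← cls_smul a h hh (cobd_smul a hh), cup_cls, cup_cls,
    ← cls_smul a _ _ (cobd_smul a (cobd_cochainCup_eq_zero hf hh))]
  exact cls_congr (cochainCup_smul_right a f h) _ _

theorem cobd_one : cobd (1 : Cochain k G 0) = 0 := by
  apply ev_ext
  intro g
  rw [ev_cobd]
  simp [ev]

/-- The unit of the cohomology ring: the class of the constant `0`-cochain `1`. -/
def unit (k G : Type u) [CommRing k] [Group G] : H k G 0 := cls 1 cobd_one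

/-! ### The cohomology ring -/

instance : GradedMonoid.GMul (H k G) where
  mul x y := cup x y

instance : GradedMonoid.GOne (H k G) where
  one := unit k G

theorem mk_unit_mul (a : GradedMonoid (H k G)) : GradedMonoid.mk 0 (unit k G) * a = a := by
  obtain ⟨n, x⟩ := a
  obtain ⟨f, hf, rfl⟩ := exists_cls x
  change GradedMonoid.mk (A := H k G) _ (cup (unit k G) (cls f hf)) = _
  rw [unit, cup_cls]
  refine mk_cls_eq (zero_add n) (fun g => ?_) _ _
  rw [ev_cochainCup]
  simp [ev]

theorem mul_mk_unit (a : GradedMonoid (H k G)) : a * GradedMonoid.mk 0 (unit k G) = a := by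
  obtain ⟨n, x⟩ := a
  obtain ⟨f, hf, rfl⟩ := exists_cls x
  change GradedMonoid.mk (A := H k G) _ (cup (cls f hf) (unit k G)) = _
  rw [unit, cup_cls]
  refine mk_cls_eq (add_zero n) (fun g => ?_) _ _
  rw [ev_cochainCup]
  simp [ev]

theorem gmul_assoc (a b c : GradedMonoid (H k G)) : a * b * c = a * (b * c) := by
  obtain ⟨l, x⟩ := a
  obtain ⟨m, y⟩ := b
  obtain ⟨n, z⟩ := c
  obtain ⟨f, hf, rfl⟩ := exists_cls x
  obtain ⟨h, hh, rfl⟩ := exists_cls y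
  obtain ⟨w, hw, rfl⟩ := exists_cls z
  change GradedMonoid.mk (A := H k G) _ (cup (cup (cls f hf) (cls h hh)) (cls w hw)) =
    GradedMonoid.mk (A := H k G) _ (cup (cls f hf) (cup (cls h hh) (cls w hw)))
  rw [cup_cls, cup_cls, cup_cls, cup_cls]
  refine mk_cls_eq (add_assoc l m n) (fun g => ?_) _ _
  simp only [ev_cochainCup, mul_assoc, add_assoc]

/-- Group cohomology with the cup product is a graded ring. -/
instance : DirectSum.GRing (H k G) where
  mul_zero {i j} x := by
    have := cup_smul_right (0 : k) x (0 : H k G j)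
    rwa [zero_smul, zero_smul] at this
  zero_mul {i j} y := by
    have := cup_smul_left (0 : k) (0 : H k G i) y
    rwa [zero_smul, zero_smul] at this
  mul_add := cup_add_right
  add_mul := cup_add_left
  one_mul := mk_unit_mul
  mul_one := mul_mk_unit
  mul_assoc := gmul_assoc
  natCast n := n • unit k G
  natCast_zero := zero_smul _ _
  natCast_succ n := succ_nsmul _ n
  intCast n := n • unit k G
  intCast_ofNat n := natCast_zsmul _ n
  intCast_negSucc_ofNat n := negSucc_zsmul _ n

theorem mk_smul_unit_mul (a : k) (x : GradedMonoid (H k G)) :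
    GradedMonoid.mk 0 (a • unit k G) * x = a • x := by
  obtain ⟨n, x⟩ := x
  have h1 := mk_unit_mul (GradedMonoid.mk n x)
  change GradedMonoid.mk (A := H k G) _ (cup (a • unit k G) x) = GradedMonoid.mk n (a • x)
  rw [cup_smul_left]
  exact congrArg (fun z : GradedMonoid (H k G) => a • z) h1

theorem mul_mk_smul_unit (a : k) (x : GradedMonoid (H k G)) :
    x * GradedMonoid.mk 0 (a • unit k G) = a • x := by
  obtain ⟨n, x⟩ := x
  have h1 := mul_mk_unit (GradedMonoid.mk n x)
  change GradedMonoid.mk (A := H k G) _ (cup x (a • unit k G)) = GradedMonoid.mk n (a • x)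
  rw [cup_smul_right]
  exact congrArg (fun z : GradedMonoid (H k G) => a • z) h1

/-- Group cohomology with the cup product is a graded `k`-algebra. -/
instance : DirectSum.GAlgebra k (H k G) where
  toFun := (LinearMap.toSpanSingleton k (H k G 0) (unit k G)).toAddMonoidHom
  map_one := one_smul k _
  map_mul a b := by
    have h1 := mk_smul_unit_mul (G := G) a (GradedMonoid.mk 0 (b • unit k G))
    have h2 : (a * b) • unit k G = a • (b • unit k G) := mul_smul a b _
    change GradedMonoid.mk (A := H k G) 0 ((a * b) • unit k G) = _
    rw [h2]
    exact h1.symm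
  commutes a x := (mk_smul_unit_mul a x).trans (mul_mk_smul_unit a x).symm
  smul_def a x := (mk_smul_unit_mul a x).symm

/-- The cohomology ring `H^*(G; k) = ⨁ₙ Hⁿ(G; k)`, whose product is the cup product. -/
abbrev CohomologyRing (k G : Type u) [CommRing k] [Group G] : Type u :=
  DirectSum ℕ (H k G)

/-- The inclusion of `Hⁿ(G; k)` into the cohomology ring. -/
abbrev incl {n : ℕ} (x : H k G n) : CohomologyRing k G := DirectSum.of (H k G) n x

theorem incl_mul_incl {m n : ℕ} (x : H k G m) (y : H k G n) :
    incl x * incl y = incl (cup x y) :=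
  DirectSum.of_mul_of x y

end GroupCohomologyRing

end

/-! ### The group -/

namespace Sapphire

/-- The generator `a₁` of the free group on `a₁, b₁, a₂`. -/
abbrev a₁ : FreeGroup (Fin 3) := FreeGroup.of 0

/-- The generator `b₁` of the free group on `a₁, b₁, a₂`. -/
abbrev b₁ : FreeGroup (Fin 3) := FreeGroup.of 1

/-- The generator `a₂` of the free group on `a₁, b₁, a₂`. -/
abbrev a₂ : FreeGroup (Fin 3) := FreeGroup.of 2

/-- The relators of `a₁ b₁ a₁⁻¹ = b₁⁻¹`, `a₂² = a₁²ʳ b₁ˢ` and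
`a₂ a₁²ᵗ b₁ᵘ a₂⁻¹ = b₁⁻ᵘ a₁⁻²ᵗ`. -/
def relators (r s t u : ℤ) : Set (FreeGroup (Fin 3)) :=
  {(a₁ * b₁ * a₁⁻¹) * (b₁⁻¹)⁻¹,
    a₂ ^ 2 * (a₁ ^ (2 * r) * b₁ ^ s)⁻¹,
    (a₂ * a₁ ^ (2 * t) * b₁ ^ u * a₂⁻¹) * (b₁ ^ (-u) * a₁ ^ (-(2 * t)))⁻¹}

/-- The fundamental group of the sapphire `K(r, s, t, u)`:
`⟨a₁, b₁, a₂ ∣ a₁ b₁ a₁⁻¹ = b₁⁻¹, a₂² = a₁²ʳ b₁ˢ, a₂ a₁²ᵗ b₁ᵘ a₂⁻¹ = b₁⁻ᵘ a₁⁻²ᵗ⟩`. -/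
abbrev SapphireGroup (r s t u : ℤ) : Type := PresentedGroup (relators r s t u)

end Sapphire

/-!
The group `G` of the sapphire is the amalgam of the Klein bottle groups `K₁ = ⟨a₁, b₁⟩` and
`K₂ = ⟨a₂, a₁²ᵗ b₁ᵘ⟩` along their common subgroup `N = ⟨x, y⟩ ≅ ℤ²`, where `x = a₁²` and `y = b₁`.
The subgroup `N` is normal in `G`, with infinite dihedral quotient generated by the reflections
`a₁` and `a₂`. The cohomology is computed by a Mayer–Vietoris argument which uses that `2` is
invertible.

All computations take place in the complex of homogeneous cochains `HCochain k G n`. It is exact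
(`acyclic_bot`), and its invariants under a subgroup `S` compute the cohomology of `S`; for
`S = G` this is Mathlib's group cohomology (`hcobd_homog`, `cls_succ_eq_zero_iff`). If an element
`τ` normalizes `S` and some `S`-invariant height function to `ℤ` increases by `1` under `τ`, then
`v ↦ v ∘ τ - v` is surjective on `S`-invariant cochains (`exists_translate_sub_eq`), which is the
input of the Wang sequence passing from `S` to `S ⋊ ⟨τ⟩`. This gives the cohomology of `⟨y⟩` and
of `N`: it vanishes above degree two, a cocycle of degree one is a coboundary if it vanishes on
`x` and `y`, and one of degree two if it vanishes on the fundamental cycle `[x | y] - [y | x]`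
(`exists_primitive_one`, `exists_primitive_two`). The required heights, and functions
`X, Y : G → k` whose coboundaries are dual to `x` and `y`, are the coordinates of an explicit
action of `G` on `ℤ³`.

A cocycle of `G` that bounds on `N` has, by averaging over `a₁` and `a₂`, primitives `v₁` and `v₂`
invariant under `K₁` and `K₂` (`exists_primitives`), and `v₁ - v₂` is a cocycle on `N`. If this is
the coboundary of some `w`, then writing `w` as the difference of a `K₁`-invariant and a
`K₂`-invariant cochain (`exists_sub_eq`) gives a primitive invariant under `G`. Conversely every
cocycle `φ₁ - φ₂` on `N` yields the cocycle `dφ₁ = dφ₂` of `G`. The element `a₁` negates `H²(N)`,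
and so does `a₂`, hence `H²(K₁) = H²(K₂) = 0` and `H³(G) ≅ H²(N) ≅ k`, and `H²(G)` is the
cokernel, `H¹(G)` the kernel of the restriction `H¹(K₁) ⊕ H¹(K₂) → H¹(N)`. The images of `H¹(K₁)`
and `H¹(K₂)` are the lines spanned by `X` and by `u X - t Y`; they coincide if `t = 0` in `k` and
are complementary if `t` is invertible.

If `t = 0` in `k`, then `α = dX` is a cocycle of `G` and `β = dφ₁ = dφ₂`, with `φ₁ - φ₂ = dY` on
`N`, generates `H²(G)`. The Leibniz rule gives `α ⌣ β = -d(α ⌣ φᵢ)`, so that `α ⌣ β` corresponds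
to the class of `-dX ⌣ dY` on the torus, which generates `H²(N)`. Finally `α ⌣ α = 0` and
`α ⌣ β = β ⌣ α` by explicit coboundaries, and `β ⌣ β = 0` for reasons of degree.
-/

noncomputable section

set_option linter.unusedSectionVars false

namespace GroupCohomologyRing

universe u

variable {k G : Type u} [CommRing k] [Group G]

/-! ### Homogeneous cochains -/

/-- Functions of `n` group elements, the values of homogeneous cochains of degree `n - 1`: the
number of arguments is used as index so that `HCochain k G 0 = k` is the augmentation term. -/
abbrev HCochain (k G : Type u) (n : ℕ) : Type u := (Fin n → G) → k

/-- The homogeneous coboundary, by recursion on the number of arguments: all summands but the first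
of `∑ⱼ (-1)ʲ F (γ₀, …, γⱼ₋₁, γⱼ₊₁, …, γₙ)` keep the argument `γ₀`. -/
def hcobdFun : {n : ℕ} → HCochain k G n → HCochain k G (n + 1)
  | 0, F => fun _ => F Fin.elim0
  | _ + 1, F => fun γ => F (Fin.tail γ) - hcobdFun (fun δ => F (Fin.cons (γ 0) δ)) (Fin.tail γ)

theorem hcobdFun_add {n : ℕ} (F F' : HCochain k G n) :
    hcobdFun (F + F') = hcobdFun F + hcobdFun F' := by
  induction n with
  | zero => rfl
  | succ n ih =>
    funext γ
    have := congrFun (ih (fun δ => F (Fin.cons (γ 0) δ)) (fun δ => F' (Fin.cons (γ 0) δ)))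
      (Fin.tail γ)
    simp only [Pi.add_apply, hcobdFun] at this ⊢
    rw [show (fun δ => F (Fin.cons (γ 0) δ) + F' (Fin.cons (γ 0) δ)) =
      (fun δ => F (Fin.cons (γ 0) δ)) + (fun δ => F' (Fin.cons (γ 0) δ)) from rfl, this]
    ring

theorem hcobdFun_smul {n : ℕ} (c : k) (F : HCochain k G n) :
    hcobdFun (c • F) = c • hcobdFun F := by
  induction n with
  | zero => rfl
  | succ n ih =>
    funext γ
    have := congrFun (ih (fun δ => F (Fin.cons (γ 0) δ))) (Fin.tail γ)
    simp only [Pi.smul_apply, hcobdFun, smul_eq_mul] at this ⊢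
    rw [show (fun δ => c * F (Fin.cons (γ 0) δ)) = c • (fun δ => F (Fin.cons (γ 0) δ)) from rfl,
      this]
    ring

/-- The homogeneous coboundary as a linear map. -/
def hcobd {n : ℕ} : HCochain k G n →ₗ[k] HCochain k G (n + 1) where
  toFun := hcobdFun
  map_add' := hcobdFun_add
  map_smul' := hcobdFun_smul

theorem hcobd_zero_apply (F : HCochain k G 0) (γ : Fin 1 → G) : hcobd F γ = F Fin.elim0 := rfl

theorem hcobd_succ_apply {n : ℕ} (F : HCochain k G (n + 1)) (γ : Fin (n + 2) → G) :
    hcobd F γ = F (Fin.tail γ) - hcobd (fun δ => F (Fin.cons (γ 0) δ)) (Fin.tail γ) := rfl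

theorem hcobd_hcobd {n : ℕ} (F : HCochain k G n) : hcobd (hcobd F) = 0 := by
  induction n with
  | zero =>
    funext γ
    simp [hcobd_succ_apply, hcobd_zero_apply]
  | succ n ih =>
    funext γ
    rw [hcobd_succ_apply]
    have h1 : (fun δ => hcobd F (Fin.cons (γ 0) δ)) =
        F - hcobd (fun δ => F (Fin.cons (γ 0) δ)) := by
      funext δ
      rw [hcobd_succ_apply]
      simp
    rw [h1, map_sub, ih]
    simp

theorem hcobd_eq_sum {n : ℕ} (F : HCochain k G n) (γ : Fin (n + 1) → G) :
    hcobd F γ = ∑ j : Fin (n + 1), (-1 : k) ^ (j : ℕ) * F (fun i => γ (j.succAbove i)) := by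
  induction n with
  | zero =>
    rw [hcobd_zero_apply, Fin.sum_univ_one]
    simp only [Fin.val_zero, pow_zero, one_mul]
    congr 1
    funext i
    exact i.elim0
  | succ n ih =>
    rw [hcobd_succ_apply, ih, sub_eq_add_neg, ← Finset.sum_neg_distrib]
    conv_rhs => rw [Fin.sum_univ_succ]
    congr 1
    · simp only [Fin.val_zero, pow_zero, one_mul, Fin.succAbove_zero]
      rfl
    · refine Finset.sum_congr rfl fun j _ => ?_
      rw [Fin.val_succ, pow_succ, mul_neg_one, neg_mul]
      congr 3
      funext i
      refine Fin.cases ?_ (fun i => ?_) i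
      · simp
      · simp [Fin.tail]

/-- Translation of the arguments of a cochain by a group element. -/
def leftTranslate {n : ℕ} (g : G) : HCochain k G n →ₗ[k] HCochain k G n where
  toFun F := fun γ => F (g • γ)
  map_add' _ _ := rfl
  map_smul' _ _ := rfl

theorem leftTranslate_apply {n : ℕ} (g : G) (F : HCochain k G n) (γ : Fin n → G) :
    leftTranslate g F γ = F (g • γ) := rfl

theorem leftTranslate_translate {n : ℕ} (g h : G) (F : HCochain k G n) :
    leftTranslate h (leftTranslate g F) = leftTranslate (g * h) F := by
  funext γ
  simp only [leftTranslate_apply, mul_smul]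

theorem leftTranslate_one {n : ℕ} (F : HCochain k G n) : leftTranslate 1 F = F := by
  funext γ
  simp only [leftTranslate_apply, one_smul]

theorem smul_cons {n : ℕ} (g h : G) (γ : Fin n → G) :
    g • (Fin.cons h γ : Fin (n + 1) → G) = Fin.cons (g * h) (g • γ) := by
  funext i
  refine Fin.cases ?_ (fun i => ?_) i <;> simp

theorem hcobd_translate {n : ℕ} (g : G) (F : HCochain k G n) :
    hcobd (leftTranslate g F) = leftTranslate g (hcobd F) := by
  induction n with
  | zero =>
    funext γ
    simp only [leftTranslate_apply, hcobd_zero_apply]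
    congr 1
    funext i
    exact i.elim0
  | succ n ih =>
    funext γ
    rw [leftTranslate_apply, hcobd_succ_apply, hcobd_succ_apply]
    have h1 : (fun δ => leftTranslate g F (Fin.cons (γ 0) δ)) =
        leftTranslate g (fun δ => F (Fin.cons ((g • γ) 0) δ)) := by
      funext δ
      simp [leftTranslate_apply, smul_cons]
    rw [h1, ih]
    rfl

/-- Insertion of `1` as first argument, a contracting homotopy of the homogeneous complex. -/
def contract {n : ℕ} (F : HCochain k G (n + 1)) : HCochain k G n := fun γ => F (Fin.cons 1 γ)

theorem hcobd_contract {n : ℕ} {F : HCochain k G (n + 1)} (hF : hcobd F = 0) :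
    hcobd (contract F) = F := by
  funext γ
  have h1 := congrFun hF (Fin.cons 1 γ)
  rw [hcobd_succ_apply, Fin.tail_cons, Fin.cons_zero] at h1
  exact (sub_eq_zero.1 h1).symm

/-! ### Invariant cochains -/

/-- The elements of the group that fix a cochain. -/
def fixer {n : ℕ} (F : HCochain k G n) : Subgroup G where
  carrier := {g | leftTranslate g F = F}
  mul_mem' {a b} ha hb := by
    change leftTranslate (a * b) F = F
    change leftTranslate a F = F at ha
    change leftTranslate b F = F at hb
    rw [← leftTranslate_translate, ha, hb]
  one_mem' := leftTranslate_one F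
  inv_mem' {a} ha := by
    change leftTranslate a⁻¹ F = F
    change leftTranslate a F = F at ha
    conv_lhs => rw [← ha]
    rw [leftTranslate_translate, mul_inv_cancel, leftTranslate_one]

theorem mem_fixer {n : ℕ} {F : HCochain k G n} {g : G} : g ∈ fixer F ↔ leftTranslate g F = F :=
  Iff.rfl

/-- The cochains that are invariant under a subgroup. For `n ≥ 1` they form the degree `n - 1` term
of a complex computing the cohomology of the subgroup. -/
def invariants (k : Type u) [CommRing k] (S : Subgroup G) (n : ℕ) :
    Submodule k (HCochain k G n) where
  carrier := {F | S ≤ fixer F}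
  zero_mem' := fun g _ => map_zero (leftTranslate g)
  add_mem' {F F'} hF hF' := fun g hg => by
    have h1 := mem_fixer.1 (hF hg)
    have h2 := mem_fixer.1 (hF' hg)
    rw [mem_fixer, map_add, h1, h2]
  smul_mem' c F hF := fun g hg => by
    have h1 := mem_fixer.1 (hF hg)
    rw [mem_fixer, map_smul, h1]

theorem mem_invariants {S : Subgroup G} {n : ℕ} {F : HCochain k G n} :
    F ∈ invariants k S n ↔ S ≤ fixer F := Iff.rfl

theorem leftTranslate_eq {S : Subgroup G} {n : ℕ} {F : HCochain k G n} (hF : F ∈ invariants k S n)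
    {g : G} (hg : g ∈ S) : leftTranslate g F = F := hF hg

theorem apply_smul_eq {S : Subgroup G} {n : ℕ} {F : HCochain k G n} (hF : F ∈ invariants k S n)
    {g : G} (hg : g ∈ S) (γ : Fin n → G) : F (g • γ) = F γ := congrFun (hF hg) γ

theorem invariants_anti {S T : Subgroup G} (h : S ≤ T) {n : ℕ} {F : HCochain k G n}
    (hF : F ∈ invariants k T n) : F ∈ invariants k S n := h.trans hF

theorem mem_invariants_sup_zpowers {S : Subgroup G} {τ : G} {n : ℕ} {F : HCochain k G n} :
    F ∈ invariants k (S ⊔ Subgroup.zpowers τ) n ↔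
      F ∈ invariants k S n ∧ leftTranslate τ F = F := by
  simp only [mem_invariants, sup_le_iff, Subgroup.zpowers_le, mem_fixer]

theorem mem_invariants_zpowers {τ : G} {n : ℕ} {F : HCochain k G n} :
    F ∈ invariants k (Subgroup.zpowers τ) n ↔ leftTranslate τ F = F := by
  simp only [mem_invariants, Subgroup.zpowers_le, mem_fixer]

theorem hcobd_mem {S : Subgroup G} {n : ℕ} {F : HCochain k G n} (hF : F ∈ invariants k S n) :
    hcobd F ∈ invariants k S (n + 1) := fun g hg => by
  rw [mem_fixer, ← hcobd_translate, leftTranslate_eq hF hg]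

theorem leftTranslate_mem {S : Subgroup G} {τ : G} (hτ : ∀ s ∈ S, τ * s * τ⁻¹ ∈ S) {n : ℕ}
    {F : HCochain k G n} (hF : F ∈ invariants k S n) : leftTranslate τ F ∈ invariants k S n :=
  fun g hg => by
    rw [mem_fixer, leftTranslate_translate]
    conv_rhs => rw [← leftTranslate_eq hF (hτ g hg), leftTranslate_translate, inv_mul_cancel_right]

/-- Cochains with no argument are constants. -/
theorem mem_invariants_zero {S : Subgroup G} (F : HCochain k G 0) : F ∈ invariants k S 0 :=
  fun g _ => by
    funext γ
    rw [leftTranslate_apply]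
    congr 1
    exact Subsingleton.elim _ _

/-- The cohomology of the complex of `S`-invariant cochains vanishes in degree `n`. -/
def Acyclic (k : Type u) [CommRing k] (S : Subgroup G) (n : ℕ) : Prop :=
  ∀ z ∈ invariants k S (n + 1), hcobd z = 0 → ∃ v ∈ invariants k S n, hcobd v = z

theorem acyclic_bot (n : ℕ) : Acyclic k (⊥ : Subgroup G) n := by
  intro z _ hz
  refine ⟨contract z, ?_, hcobd_contract hz⟩
  intro g hg
  rw [Subgroup.mem_bot.1 hg]
  exact leftTranslate_one _

/-- The restriction of a `1`-cocycle to a subgroup fixing it is a homomorphism, and the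
contraction of the cocycle is invariant under the kernel. -/
theorem leftTranslate_contract {F : HCochain k G 2} (hF : hcobd F = 0) {s : G}
    (hs : leftTranslate s F = F) (h1 : F ![1, s] = 0) :
    leftTranslate s (contract F) = contract F := by
  funext γ
  have h2 := congrFun hF ![1, s, s * γ 0]
  have h3 := congrFun hs ![1, γ 0]
  rw [hcobd_eq_sum, Fin.sum_univ_three] at h2
  have e1 : (fun i => (![1, s, s * γ 0] : Fin 3 → G) ((0 : Fin 3).succAbove i)) =
    s • ![1, γ 0] := by
    funext i; fin_cases i <;> simp [Fin.succAbove]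
  have e2 : (fun i => (![1, s, s * γ 0] : Fin 3 → G) ((1 : Fin 3).succAbove i)) =
    Fin.cons 1 (s • γ) := by
    funext i; fin_cases i <;> simp [Fin.succAbove]
  have e3 : (fun i => (![1, s, s * γ 0] : Fin 3 → G) ((2 : Fin 3).succAbove i)) =
    ![1, s] := by
    funext i; fin_cases i <;> simp [Fin.succAbove]
  have e4 : (Fin.cons 1 γ : Fin 2 → G) = ![1, γ 0] := by
    funext i; fin_cases i <;> simp
  rw [e1, e2, e3, h1, ← leftTranslate_apply s F, h3] at h2
  simp only [leftTranslate_apply, contract]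
  rw [e4]
  simp at h2
  linear_combination -h2

/-! ### Summation along a free direction -/

/-- A primitive for the difference operator on functions on `ℤ`. -/
def intSum (c : ℤ → k) : ℤ → k
  | Int.ofNat n => ∑ j ∈ Finset.range n, c j
  | Int.negSucc n => -∑ j ∈ Finset.range (n + 1), c (Int.negSucc j)

theorem intSum_add_one (c : ℤ → k) (i : ℤ) : intSum c (i + 1) = intSum c i + c i := by
  rcases i with n | n
  · exact Finset.sum_range_succ _ n
  · cases n with
    | zero =>
      change ∑ j ∈ Finset.range 0, c j = -∑ j ∈ Finset.range 1, c (Int.negSucc j) + c (-1)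
      simp
    | succ n =>
      change -∑ j ∈ Finset.range (n + 1), c (Int.negSucc j) =
        -∑ j ∈ Finset.range (n + 1 + 1), c (Int.negSucc j) + c (Int.negSucc (n + 1))
      rw [Finset.sum_range_succ _ (n + 1)]
      ring

/-- If `τ` normalizes `S` and acts freely in the sense that some `S`-invariant height function
increases by `1` under `τ`, then `v ↦ v ∘ τ - v` is surjective on `S`-invariant cochains. -/
theorem exists_translate_sub_eq {S : Subgroup G} {τ : G} (hτ : τ ∈ Subgroup.normalizer (S : Set G))
    (ht : G → ℤ) (hS : ∀ s ∈ S, ∀ g, ht (s * g) = ht g) (h1 : ∀ g, ht (τ * g) = ht g + 1) {n : ℕ}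
    {w : HCochain k G (n + 1)} (hw : w ∈ invariants k S (n + 1)) :
    ∃ v ∈ invariants k S (n + 1), leftTranslate τ v - v = w := by
  refine ⟨fun γ => intSum (fun i => w (τ ^ (i - ht (γ 0)) • γ)) (ht (γ 0)), ?_, ?_⟩
  · intro s hs
    rw [mem_fixer]
    funext γ
    rw [leftTranslate_apply]
    have h2 : ht ((s • γ) 0) = ht (γ 0) := hS s hs _
    simp only [h2]
    congr 1
    funext i
    have h3 := zpow_mem hτ (i - ht (γ 0))
    rw [smul_smul]
    conv_rhs => rw [← apply_smul_eq hw ((Subgroup.mem_normalizer_iff.1 h3 s).1 hs), smul_smul,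
      inv_mul_cancel_right]
  · funext γ
    rw [Pi.sub_apply, leftTranslate_apply]
    have h2 : ht ((τ • γ) 0) = ht (γ 0) + 1 := h1 _
    have h3 : ∀ i : ℤ, τ ^ (i - (ht (γ 0) + 1)) • τ • γ = τ ^ (i - ht (γ 0)) • γ := by
      intro i
      rw [smul_smul, ← zpow_add_one]
      congr 2
      ring
    simp only [h2, h3, intSum_add_one, sub_self, zpow_zero, one_smul]
    ring

/-- Vanishing of cohomology in consecutive degrees passes from `S` to `S ⋊ ⟨τ⟩`, at the cost of one
degree: a piece of the Wang sequence. -/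
theorem Acyclic.sup_zpowers {S : Subgroup G} {τ : G} (hτ : τ ∈ Subgroup.normalizer (S : Set G))
    (ht : G → ℤ) (hS : ∀ s ∈ S, ∀ g, ht (s * g) = ht g) (h1 : ∀ g, ht (τ * g) = ht g + 1) {n : ℕ}
    (A : Acyclic k S (n + 1)) (A' : Acyclic k S (n + 2)) :
    Acyclic k (S ⊔ Subgroup.zpowers τ) (n + 2) := by
  intro z hz dz
  obtain ⟨hz, hz'⟩ := mem_invariants_sup_zpowers.1 hz
  obtain ⟨v, hv, rfl⟩ := A' z hz dz
  have hτv : leftTranslate τ v ∈ invariants k S (n + 2) :=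
    leftTranslate_mem (fun s hs => (Subgroup.mem_normalizer_iff.1 hτ s).1 hs) hv
  obtain ⟨w, hw, dw⟩ := A (leftTranslate τ v - v) (sub_mem hτv hv)
    (by rw [map_sub, hcobd_translate, hz', sub_self])
  obtain ⟨w', hw', rfl⟩ := exists_translate_sub_eq hτ ht hS h1 hw
  refine ⟨v - hcobd w', mem_invariants_sup_zpowers.2 ⟨sub_mem hv (hcobd_mem hw'), ?_⟩, ?_⟩
  · rw [map_sub, ← hcobd_translate]
    rw [map_sub] at dw
    linear_combination -dw
  · rw [map_sub, hcobd_hcobd, sub_zero]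

/-! ### Averaging and gluing over an infinite dihedral quotient -/

section Dihedral

variable {N : Subgroup G} [N.Normal] {a b : G}

theorem leftTranslate_mem_of_normal (g : G) {n : ℕ} {F : HCochain k G n}
    (hF : F ∈ invariants k N n) : leftTranslate g F ∈ invariants k N n :=
  leftTranslate_mem (fun s hs => Subgroup.Normal.conj_mem inferInstance s hs g) hF

theorem leftTranslate_congr {n : ℕ} {F : HCochain k G n} (hF : F ∈ invariants k N n) {g h : G}
    (hgh : g * h⁻¹ ∈ N) : leftTranslate g F = leftTranslate h F := by
  rw [← inv_mul_cancel_right g h, ← leftTranslate_translate, leftTranslate_eq hF hgh]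

/-- If `2` is invertible and `a² ∈ N`, a primitive of an `a`-invariant cochain can be averaged to an
`a`-invariant one. -/
theorem exists_average [Invertible (2 : k)] (ha : a * a ∈ N) {n : ℕ} {v : HCochain k G n}
    (hv : v ∈ invariants k N n) (hz : leftTranslate a (hcobd v) = hcobd v) :
    ∃ v' ∈ invariants k N n, leftTranslate a v' = v' ∧ hcobd v' = hcobd v := by
  refine ⟨(⅟2 : k) • (v + leftTranslate a v),
    Submodule.smul_mem _ _ (add_mem hv (leftTranslate_mem_of_normal a hv)), ?_, ?_⟩
  · rw [map_smul, map_add, leftTranslate_translate, leftTranslate_eq hv ha,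
      add_comm (leftTranslate a v)]
  · rw [map_smul, map_add, hcobd_translate, hz, ← two_smul k, smul_smul, invOf_mul_self, one_smul]

/-- Every `N`-invariant cochain is the difference of an `a`-invariant and a `b`-invariant one, if
`a` and `b` map to generating reflections of an infinite dihedral quotient by `N`. -/
theorem exists_sub_eq [Invertible (2 : k)] (ha : a * a ∈ N) (hb : b * b ∈ N)
    (ht : G → ℤ) (hN : ∀ s ∈ N, ∀ g, ht (s * g) = ht g) (h1 : ∀ g, ht (b * a * g) = ht g + 1)
    {n : ℕ} {φ : HCochain k G (n + 1)} (hφ : φ ∈ invariants k N (n + 1)) :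
    ∃ φ₁ ∈ invariants k N (n + 1), ∃ φ₂ ∈ invariants k N (n + 1),
      leftTranslate a φ₁ = φ₁ ∧ leftTranslate b φ₂ = φ₂ ∧ φ₁ - φ₂ = φ := by
  have hn : b * a ∈ Subgroup.normalizer (N : Set G) := by
    rw [Subgroup.normalizer_eq_top]; trivial
  -- `φ₁` is `a`-invariant and `φ₁ - φ` is `b`-invariant iff `φ₁` is an `a`-invariant solution of
  -- the difference equation below; averaging over `a` makes any solution `a`-invariant.
  obtain ⟨v, hv, e⟩ := exists_translate_sub_eq hn ht hN h1
    (sub_mem (leftTranslate_mem_of_normal (b * a) hφ) (leftTranslate_mem_of_normal a hφ))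
  have e' : leftTranslate (b * a) (leftTranslate a v) - leftTranslate a v =
      leftTranslate (b * a) φ - leftTranslate a φ := by
    have h2 := congrArg (leftTranslate ((b * a)⁻¹ * a)) e
    simp only [map_sub, leftTranslate_translate] at h2
    rw [mul_inv_cancel_left, leftTranslate_congr hv (g := (b * a)⁻¹ * a) (h := a * (b * a)),
      leftTranslate_congr hφ (g := a * ((b * a)⁻¹ * a)) (h := b * a)] at h2
    · rw [leftTranslate_translate]
      linear_combination -h2
    · rw [show a * ((b * a)⁻¹ * a) * (b * a)⁻¹ = (b * b)⁻¹ by group]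
      exact inv_mem hb
    · rw [show (b * a)⁻¹ * a * (a * (b * a))⁻¹ = a⁻¹ * (b * b)⁻¹ * a⁻¹⁻¹ * (a * a)⁻¹ by group]
      exact mul_mem (Subgroup.Normal.conj_mem inferInstance _ (inv_mem hb) _) (inv_mem ha)
  have e₁ : leftTranslate a ((⅟2 : k) • (v + leftTranslate a v)) =
      (⅟2 : k) • (v + leftTranslate a v) := by
    rw [map_smul, map_add, leftTranslate_translate, leftTranslate_eq hv ha,
      add_comm (leftTranslate a v)]
  refine ⟨(⅟2 : k) • (v + leftTranslate a v), ?_,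
    (⅟2 : k) • (v + leftTranslate a v) - φ, ?_, ?_, ?_, ?_⟩
  · exact Submodule.smul_mem _ _ (add_mem hv (leftTranslate_mem_of_normal a hv))
  · exact sub_mem (Submodule.smul_mem _ _ (add_mem hv (leftTranslate_mem_of_normal a hv))) hφ
  · exact e₁
  · have h3 : leftTranslate (b * a) ((⅟2 : k) • (v + leftTranslate a v)) -
        (⅟2 : k) • (v + leftTranslate a v) = leftTranslate (b * a) φ - leftTranslate a φ := by
      rw [map_smul, ← smul_sub, map_add, add_sub_add_comm, e, e', ← two_smul k, smul_smul,
        invOf_mul_self, one_smul]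
    have h4 := congrArg (leftTranslate a⁻¹) h3
    have e₂ : leftTranslate a⁻¹ ((⅟2 : k) • (v + leftTranslate a v)) =
        (⅟2 : k) • (v + leftTranslate a v) := by
      conv_lhs => rw [← e₁, leftTranslate_translate, mul_inv_cancel, leftTranslate_one]
    simp only [map_sub, leftTranslate_translate, mul_inv_cancel_right, mul_inv_cancel,
      leftTranslate_one,
      e₂] at h4
    rw [map_sub]
    linear_combination h4
  · exact sub_sub_cancel _ _

/-- Two primitives of a cocycle, one invariant under `a` and one under `b`, whose difference is an
`N`-coboundary can be modified to a common invariant primitive. -/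
theorem exists_glue [Invertible (2 : k)] (ha : a * a ∈ N) (hb : b * b ∈ N)
    (ht : G → ℤ) (hN : ∀ s ∈ N, ∀ g, ht (s * g) = ht g) (h1 : ∀ g, ht (b * a * g) = ht g + 1)
    (htop : N ⊔ Subgroup.zpowers a ⊔ Subgroup.zpowers b = ⊤)
    {n : ℕ} {v₁ v₂ : HCochain k G (n + 2)} (hv₁ : v₁ ∈ invariants k N (n + 2))
    (ha₁ : leftTranslate a v₁ = v₁)
    (hb₂ : leftTranslate b v₂ = v₂) {w : HCochain k G (n + 1)} (hw : w ∈ invariants k N (n + 1))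
    (e : v₁ - v₂ = hcobd w) :
    ∃ v ∈ invariants k (⊤ : Subgroup G) (n + 2), hcobd v = hcobd v₁ := by
  obtain ⟨w₁, hw₁, w₂, hw₂, ha', hb', rfl⟩ := exists_sub_eq ha hb ht hN h1 hw
  refine ⟨v₁ - hcobd w₁, ?_, by rw [map_sub, hcobd_hcobd, sub_zero]⟩
  rw [← htop, mem_invariants_sup_zpowers, mem_invariants_sup_zpowers]
  refine ⟨⟨sub_mem hv₁ (hcobd_mem hw₁), by rw [map_sub, ← hcobd_translate, ha₁, ha']⟩, ?_⟩
  have h2 : v₁ - hcobd w₁ = v₂ - hcobd w₂ := by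
    rw [map_sub] at e
    linear_combination e
  rw [h2, map_sub, ← hcobd_translate, hb₂, hb']

end Dihedral

/-! ### Comparison with inhomogeneous cochains -/

/-- The homogeneous cochain `(γ₀, …, γₙ) ↦ f (γ₀⁻¹ γ₁, …, γₙ₋₁⁻¹ γₙ)`. -/
def homog {n : ℕ} (f : Cochain k G n) : HCochain k G (n + 1) :=
  fun γ => f (fun i => (γ i.castSucc)⁻¹ * γ i.succ)

theorem homog_mem {n : ℕ} (f : Cochain k G n) :
    homog f ∈ invariants k (⊤ : Subgroup G) (n + 1) := fun g _ => by
  rw [mem_fixer]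
  funext γ
  rw [leftTranslate_apply]
  unfold homog
  congr 1
  funext i
  simp only [Pi.smul_apply, smul_eq_mul]
  group

theorem homog_partialProd {n : ℕ} (f : Cochain k G n) (g : Fin n → G) :
    homog f (Fin.partialProd g) = f g := by
  unfold homog
  congr 1
  funext i
  exact Fin.partialProd_right_inv g i

theorem ext_of_partialProd {n : ℕ} {F F' : HCochain k G (n + 1)}
    (hF : F ∈ invariants k (⊤ : Subgroup G) (n + 1))
    (hF' : F' ∈ invariants k (⊤ : Subgroup G) (n + 1))
    (h : ∀ g : Fin n → G, F (Fin.partialProd g) = F' (Fin.partialProd g)) : F = F' := by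
  funext γ
  rw [← Fin.partialProd_left_inv γ, apply_smul_eq hF (Subgroup.mem_top _),
    apply_smul_eq hF' (Subgroup.mem_top _), h]

theorem homog_injective {n : ℕ} : Function.Injective (homog (k := k) (G := G) (n := n)) := by
  intro f f' h
  funext g
  rw [← homog_partialProd f, h, homog_partialProd]

theorem exists_homog {n : ℕ} {F : HCochain k G (n + 1)}
    (hF : F ∈ invariants k (⊤ : Subgroup G) (n + 1)) : ∃ f : Cochain k G n, homog f = F :=
  ⟨fun g => F (Fin.partialProd g), ext_of_partialProd (homog_mem _) hF fun g =>
    homog_partialProd _ g⟩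

theorem hcobd_homog {n : ℕ} (f : Cochain k G n) : hcobd (homog f) = homog (cobd f) := by
  refine ext_of_partialProd (hcobd_mem (homog_mem f)) (homog_mem _) fun g => ?_
  rw [homog_partialProd, hcobd_eq_sum]
  refine Eq.trans ?_ (inhomogeneousCochains.d_hom_apply (Rep.trivial k G k) n f g).symm
  rw [Fin.sum_univ_succ]
  congr 1
  · simp only [Fin.val_zero, pow_zero, one_mul, Fin.succAbove_zero]
    unfold homog
    refine congrArg f (funext fun i => ?_)
    exact Fin.partialProd_right_inv g i.succ
  · refine Finset.sum_congr rfl fun j _ => ?_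
    rw [Fin.val_succ, smul_eq_mul]
    unfold homog
    congr 2
    funext i
    rw [← Fin.inv_partialProd_mul_eq_contractNth g j i]
    simp only [Fin.succ_succAbove_succ]

theorem homog_add {n : ℕ} (f f' : Cochain k G n) : homog (f + f') = homog f + homog f' := rfl

theorem homog_smul {n : ℕ} (c : k) (f : Cochain k G n) : homog (c • f) = c • homog f := rfl

theorem homog_zero {n : ℕ} : homog (0 : Cochain k G n) = 0 := rfl

theorem hcobd_homog_eq_zero {n : ℕ} {f : Cochain k G n} : hcobd (homog f) = 0 ↔ cobd f = 0 := by
  rw [hcobd_homog, ← homog_zero, homog_injective.eq_iff]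

theorem cls_succ_eq_zero_iff {n : ℕ} (f : Cochain k G (n + 1)) (hf : cobd f = 0) :
    cls f hf = 0 ↔ ∃ v ∈ invariants k (⊤ : Subgroup G) (n + 1), hcobd v = homog f := by
  rw [cls_eq_zero_iff]
  constructor
  · rintro (rfl | ⟨i, φ, hi, h⟩)
    · exact ⟨0, zero_mem _, map_zero _⟩
    · obtain rfl : i = n := by omega
      exact ⟨homog φ, homog_mem φ, by rw [hcobd_homog, ev_ext h]⟩
  · rintro ⟨v, hv, e⟩
    obtain ⟨φ, rfl⟩ := exists_homog hv
    rw [hcobd_homog] at e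
    exact Or.inr ⟨n, φ, rfl, fun g => by rw [homog_injective e]⟩

theorem subsingleton_H {n : ℕ} (h : Acyclic k (⊤ : Subgroup G) (n + 1)) :
    Subsingleton (H k G (n + 1)) := by
  refine subsingleton_of_forall_eq 0 fun x => ?_
  obtain ⟨f, hf, rfl⟩ := exists_cls x
  rw [cls_succ_eq_zero_iff]
  exact h _ (homog_mem f) (hcobd_homog_eq_zero.2 hf)

theorem span_cls_eq_top {n : ℕ} {f : Cochain k G (n + 1)} (hf : cobd f = 0)
    (h : ∀ z ∈ invariants k (⊤ : Subgroup G) (n + 2), hcobd z = 0 →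
      ∃ c : k, ∃ v ∈ invariants k (⊤ : Subgroup G) (n + 1), hcobd v = z - c • homog f) :
    Submodule.span k {cls f hf} = ⊤ := by
  refine eq_top_iff.2 fun x _ => ?_
  obtain ⟨f', hf', rfl⟩ := exists_cls x
  obtain ⟨c, v, hv, e⟩ := h _ (homog_mem f') (hcobd_homog_eq_zero.2 hf')
  refine Submodule.mem_span_singleton.2 ⟨c, ?_⟩
  have h1 : cobd (f' + (-c) • f) = 0 := cobd_add hf' (cobd_smul _ hf)
  have h2 : cls (f' + (-c) • f) h1 = 0 := by
    rw [cls_succ_eq_zero_iff]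
    refine ⟨v, hv, ?_⟩
    rw [e, homog_add, homog_smul, neg_smul, sub_eq_add_neg]
  rw [cls_add f' _ hf' (cobd_smul _ hf), cls_smul _ f hf, neg_smul] at h2
  exact (add_neg_eq_zero.1 h2).symm

/-! ### Products with a cocycle of degree one -/

/-- The product of the coboundary of a function `X` on the group with a homogeneous cochain. -/
def mulDiff (X : G → k) {n : ℕ} (F : HCochain k G (n + 1)) : HCochain k G (n + 2) :=
  fun γ => (X (γ 1) - X (γ 0)) * F (Fin.tail γ)

theorem hcobd_mul_apply (X : G → k) {n : ℕ} (F : HCochain k G (n + 1)) (γ : Fin (n + 2) → G) :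
    hcobd (fun δ => X (δ 0) * F δ) γ = X (γ 0) * hcobd F γ + mulDiff X F γ := by
  have h1 : (fun δ : Fin n → G => X ((Fin.cons (γ 0) δ : Fin (n + 1) → G) 0) *
      F (Fin.cons (γ 0) δ)) = X (γ 0) • (fun δ => F (Fin.cons (γ 0) δ)) := rfl
  rw [hcobd_succ_apply, hcobd_succ_apply F, h1, map_smul, Pi.smul_apply, smul_eq_mul]
  unfold mulDiff
  change X (γ 1) * _ - _ = _
  ring

/-- The Leibniz rule for products with the coboundary of a function. -/
theorem hcobd_mulDiff (X : G → k) {n : ℕ} (F : HCochain k G (n + 1)) :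
    hcobd (mulDiff X F) = -mulDiff X (hcobd F) := by
  funext γ
  have h1 : (fun δ : Fin (n + 1) → G => mulDiff X F (Fin.cons (γ 0) δ)) =
      (fun δ => X (δ 0) * F δ) - X (γ 0) • F := by
    funext δ
    change (X (δ 0) - X (γ 0)) * F δ = X (δ 0) * F δ - X (γ 0) * F δ
    ring
  rw [hcobd_succ_apply, h1, map_sub, map_smul, Pi.sub_apply, hcobd_mul_apply, Pi.smul_apply,
    smul_eq_mul, Pi.neg_apply]
  unfold mulDiff
  change _ - (X (γ 1) * hcobd F (Fin.tail γ) + _ - _) = _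
  simp only [Fin.tail]
  ring

theorem leftTranslate_mulDiff {X X' : G → k} {g : G} {c : k} (hX : ∀ h, X (g * h) = X' h + c)
    {n : ℕ} (F : HCochain k G (n + 1)) :
    leftTranslate g (mulDiff X F) = mulDiff X' (leftTranslate g F) := by
  funext γ
  change (X (g * γ 1) - X (g * γ 0)) * F (Fin.tail (g • γ)) = (X' (γ 1) - X' (γ 0)) * F _
  rw [hX, hX]
  congr 1
  ring

/-- The coboundary of a function on the group. -/
def diff (X : G → k) : HCochain k G 2 := fun γ => X (γ 1) - X (γ 0)

theorem diff_eq (X : G → k) : diff X = hcobd (fun γ : Fin 1 → G => X (γ 0)) := by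
  funext γ
  rfl

theorem hcobd_diff (X : G → k) : hcobd (diff X) = 0 := by
  rw [diff_eq, hcobd_hcobd]

theorem leftTranslate_diff {X X' : G → k} {g : G} {c : k} (hX : ∀ h, X (g * h) = X' h + c) :
    leftTranslate g (diff X) = diff X' := by
  funext γ
  change X (g * γ 1) - X (g * γ 0) = X' (γ 1) - X' (γ 0)
  rw [hX, hX]
  ring

/-! ### Cup products in degrees one and two -/

theorem cls_eq_of_ev_sub {n : ℕ} {f f' : Cochain k G (n + 1)} (φ : Cochain k G n)
    (hf : cobd f = 0) (hf' : cobd f' = 0) (h : ∀ g, ev f g - ev f' g = ev (cobd φ) g) :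
    cls f hf = cls f' hf' := by
  have h1 : cobd (f + (-1 : k) • f') = 0 := cobd_add hf (cobd_smul _ hf')
  have h2 : cls (f + (-1 : k) • f') h1 = 0 := by
    refine (cls_eq_zero_iff _ _).2 (Or.inr ⟨n, φ, rfl, fun g => ?_⟩)
    rw [← h]
    change ev f g + (-1) * ev f' g = _
    ring
  rw [cls_add f _ hf (cobd_smul _ hf'), cls_smul _ f' hf', neg_one_smul] at h2
  exact add_neg_eq_zero.1 h2

theorem ev_one (f : Cochain k G 1) (g : ℕ → G) : ev f g = f ![g 0] :=
  congrArg f (funext fun i => by fin_cases i; rfl)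

theorem ev_two (f : Cochain k G 2) (g : ℕ → G) : ev f g = f ![g 0, g 1] :=
  congrArg f (funext fun i => by fin_cases i <;> rfl)

theorem apply_mul_of_cobd_eq_zero {f : Cochain k G 1} (hf : cobd f = 0) (g h : G) :
    f ![g * h] = f ![g] + f ![h] := by
  have h1 := ev_cobd f (fun i => if i = 0 then g else h)
  rw [hf] at h1
  simp only [ev_one, contr, Finset.sum_range_succ, Finset.sum_range_zero] at h1
  simp [ev] at h1
  linear_combination h1

theorem apply_of_cobd_eq_zero {f : Cochain k G 2} (hf : cobd f = 0) (g₀ g₁ g₂ : G) :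
    f ![g₁, g₂] - f ![g₀ * g₁, g₂] + f ![g₀, g₁ * g₂] - f ![g₀, g₁] = 0 := by
  have h1 := ev_cobd f (fun i => if i = 0 then g₀ else if i = 1 then g₁ else g₂)
  rw [hf] at h1
  simp only [ev_two, contr, Finset.sum_range_succ, Finset.sum_range_zero] at h1
  simp [ev] at h1
  linear_combination -h1

/-- Classes of degree one and two commute: the coboundary of `(g, h) ↦ α (g h) β (g, h)` is
`β ⌣ α - α ⌣ β`. -/
theorem cup_comm_one_two (x : H k G 1) (y : H k G 2) :
    (cup y x : H k G 3) = (cup x y : H k G 3) := by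
  obtain ⟨f, hf, rfl⟩ := exists_cls x
  obtain ⟨h, hh, rfl⟩ := exists_cls y
  rw [cup_cls, cup_cls]
  refine cls_eq_of_ev_sub (n := 2) (fun g => f ![g 0 * g 1] * h g) _ _ fun g => ?_
  rw [ev_cobd, ev_cochainCup h f, ev_cochainCup f h]
  simp only [ev_one, ev_two, contr, Finset.sum_range_succ, Finset.sum_range_zero]
  simp [apply_mul_of_cobd_eq_zero hf]
  linear_combination -(f ![g 0] + f ![g 1] + f ![g 2]) *
    apply_of_cobd_eq_zero hh (g 0) (g 1) (g 2)

/-- Classes of degree one have square zero if `2` is invertible: the coboundary of `-α² / 2` is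
`α ⌣ α`. -/
theorem cup_self_one [Invertible (2 : k)] (x : H k G 1) : (cup x x : H k G 2) = 0 := by
  obtain ⟨f, hf, rfl⟩ := exists_cls x
  rw [cup_cls]
  refine (cls_eq_zero_iff _ _).2 (Or.inr ⟨1, fun g => -(⅟2 * f g * f g), rfl, fun g => ?_⟩)
  rw [ev_cobd, ev_cochainCup]
  simp only [ev_one, contr, Finset.sum_range_succ, Finset.sum_range_zero]
  simp [apply_mul_of_cobd_eq_zero hf]
  linear_combination -(f ![g 0] * f ![g 1]) * (invOf_mul_self (2 : k))

theorem nonempty_linearEquiv {k : Type u} [Field k] {M : Type u} [AddCommGroup M] [Module k M]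
    {x : M} (hx : x ≠ 0) (h : Submodule.span k {x} = ⊤) : Nonempty (M ≃ₗ[k] k) :=
  ⟨(LinearEquiv.ofTop _ h).symm.trans (LinearEquiv.toSpanNonzeroSingleton k M x hx).symm⟩

end GroupCohomologyRing

namespace Sapphire

open GroupCohomologyRing

/-! ### The action of the sapphire group on `ℤ³` -/

section Action

variable (r s t u : ℤ)

/-- The first coordinate of the image of `(v, w)` under the linear reflection that fixes `(r, s)`
and negates `(t, u)`. The determinant `r u - s t` occurs as a factor in place of its inverse, which
makes no difference if its square is `1`. -/
def reflFst {R : Type*} [CommRing R] (r s t u v w : R) : R :=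
  (r * u - s * t) * ((r * u + s * t) * v - 2 * r * t * w)

/-- The second coordinate of the reflection whose first coordinate is `reflFst`. -/
def reflSnd {R : Type*} [CommRing R] (r s t u v w : R) : R :=
  (r * u - s * t) * (2 * s * u * v - (r * u + s * t) * w)

/-- The action of `a₁` on `ℤ³`. In this and the following permutations the first two coordinates are
those of the plane on which the torus subgroup acts by the translations in `(2ℤ)²`, and the last one
is the position in an infinite chain of edges, on which `a₁` and `a₂` act as the reflections in the
end points of the edge `0`. -/
def permA₁ : Equiv.Perm (ℤ × ℤ × ℤ) where
  toFun p := (p.1 + 1, -p.2.1, -1 - p.2.2)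
  invFun p := (p.1 - 1, -p.2.1, -1 - p.2.2)
  left_inv p := by ext <;> simp
  right_inv p := by ext <;> simp

/-- The action of `b₁` on `ℤ³`, a translation. -/
def permB₁ : Equiv.Perm (ℤ × ℤ × ℤ) where
  toFun p := (p.1, p.2.1 + 2, p.2.2)
  invFun p := (p.1, p.2.1 - 2, p.2.2)
  left_inv p := by ext <;> simp
  right_inv p := by ext <;> simp

variable {r s t u}

theorem refl_refl_fst (h : (r * u - s * t) ^ 2 = 1) (v w : ℤ) :
    reflFst r s t u (reflFst r s t u v w) (reflSnd r s t u v w) = v := by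
  unfold reflFst reflSnd
  linear_combination (v * (r * u - s * t) ^ 2 + v) * h

theorem refl_refl_snd (h : (r * u - s * t) ^ 2 = 1) (v w : ℤ) :
    reflSnd r s t u (reflFst r s t u v w) (reflSnd r s t u v w) = w := by
  unfold reflFst reflSnd
  linear_combination (w * (r * u - s * t) ^ 2 + w) * h

/-- The action of `a₂` on `ℤ³`. -/
def permA₂ (h : (r * u - s * t) ^ 2 = 1) : Equiv.Perm (ℤ × ℤ × ℤ) where
  toFun p := (reflFst r s t u p.1 p.2.1 + r, reflSnd r s t u p.1 p.2.1 + s, 1 - p.2.2)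
  invFun p := (reflFst r s t u (p.1 - r) (p.2.1 - s), reflSnd r s t u (p.1 - r) (p.2.1 - s),
    1 - p.2.2)
  left_inv p := by
    simp only [add_sub_cancel_right, refl_refl_fst h, refl_refl_snd h, sub_sub_cancel]
  right_inv p := by
    simp only [sub_add_cancel, refl_refl_fst h, refl_refl_snd h, sub_sub_cancel]

/-- Translations of the plane. -/
def permTranslate (v w : ℤ) : Equiv.Perm (ℤ × ℤ × ℤ) where
  toFun p := (p.1 + v, p.2.1 + w, p.2.2)
  invFun p := (p.1 - v, p.2.1 - w, p.2.2)
  left_inv p := by ext <;> simp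
  right_inv p := by ext <;> simp

theorem permTranslate_zpow (v w n : ℤ) :
    permTranslate v w ^ n = permTranslate (n * v) (n * w) := by
  induction n with
  | zero => ext p <;> simp [permTranslate]
  | succ n ih =>
    rw [zpow_add_one, ih]
    ext p <;> simp [permTranslate] <;> ring
  | pred n ih =>
    rw [zpow_sub_one, ih, mul_inv_eq_iff_eq_mul]
    ext p <;> simp [permTranslate] <;> ring

theorem permA₁_zpow (n : ℤ) : permA₁ ^ (2 * n) = permTranslate (2 * n) 0 := by
  have h : permA₁ ^ (2 : ℤ) = permTranslate 2 0 := by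
    rw [zpow_two]
    ext p
    · simp [permTranslate, permA₁]
      ring
    · simp [permTranslate, permA₁]
    · simp [permTranslate, permA₁]
  rw [zpow_mul, h, permTranslate_zpow]
  congr 1 <;> ring

theorem permB₁_zpow (n : ℤ) : permB₁ ^ n = permTranslate 0 (2 * n) := by
  have h : permB₁ = permTranslate 0 2 := by
    ext p <;> simp [permTranslate, permB₁]
  rw [h, permTranslate_zpow]
  congr 1 <;> ring

/-- The images of the generators in the permutations of `ℤ³`. -/
def permGen (h : (r * u - s * t) ^ 2 = 1) : Fin 3 → Equiv.Perm (ℤ × ℤ × ℤ) :=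
  ![permA₁, permB₁, permA₂ h]

theorem lift_permGen (h : (r * u - s * t) ^ 2 = 1) :
    ∀ w ∈ relators r s t u, FreeGroup.lift (permGen h) w = 1 := by
  have e₁ : permGen h 0 = permA₁ := rfl
  have e₂ : permGen h 1 = permB₁ := rfl
  have e₃ : permGen h 2 = permA₂ h := rfl
  rintro w (rfl | rfl | rfl)
  · rw [map_mul, map_inv, mul_inv_eq_one]
    simp only [map_mul, map_inv, FreeGroup.lift_apply_of, e₁, e₂]
    rw [mul_inv_eq_iff_eq_mul, eq_inv_mul_iff_mul_eq]
    ext p <;> simp [permA₁, permB₁]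
  · rw [map_mul, map_inv, mul_inv_eq_one]
    simp only [map_mul, map_zpow, FreeGroup.lift_apply_of, e₁, e₂, e₃, permA₁_zpow,
      permB₁_zpow, pow_two]
    ext p
    · simp [permA₂, permTranslate, reflFst, reflSnd]
      linear_combination (p.1 * ((r * u - s * t) ^ 2 + 1) + r) * h
    · simp [permA₂, permTranslate, reflFst, reflSnd]
      linear_combination (p.2.1 * ((r * u - s * t) ^ 2 + 1) + s) * h
    · simp [permA₂, permTranslate]
  · rw [map_mul, map_inv, mul_inv_eq_one]
    simp only [map_mul, map_zpow, map_inv, FreeGroup.lift_apply_of, e₁, e₂, e₃,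
      ← mul_neg, permA₁_zpow, permB₁_zpow]
    rw [mul_inv_eq_iff_eq_mul]
    ext p
    · simp [permA₂, permTranslate, reflFst, reflSnd]
      linear_combination (-2 * t) * h
    · simp [permA₂, permTranslate, reflFst, reflSnd]
      linear_combination (-2 * u) * h
    · simp [permA₂, permTranslate]

/-- The orbit map of the origin. -/
def position (h : (r * u - s * t) ^ 2 = 1) (g : SapphireGroup r s t u) : ℤ × ℤ × ℤ :=
  PresentedGroup.toGroup (lift_permGen h) g (0, 0, 0)

variable (r s t u) in
/-- The class of `a₁`. -/
abbrev gA : SapphireGroup r s t u := PresentedGroup.of 0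

variable (r s t u) in
/-- The class of `b₁`. -/
abbrev gY : SapphireGroup r s t u := PresentedGroup.of 1

variable (r s t u) in
/-- The class of `a₂`. -/
abbrev gB : SapphireGroup r s t u := PresentedGroup.of 2

variable (r s t u) in
/-- The class of `a₁²`. -/
abbrev gX : SapphireGroup r s t u := gA r s t u * gA r s t u

theorem position_gA_mul (h : (r * u - s * t) ^ 2 = 1) (g : SapphireGroup r s t u) :
    position h (gA r s t u * g) = permA₁ (position h g) := by
  unfold position
  rw [map_mul, PresentedGroup.toGroup.of]
  rfl

theorem position_gY_mul (h : (r * u - s * t) ^ 2 = 1) (g : SapphireGroup r s t u) :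
    position h (gY r s t u * g) = permB₁ (position h g) := by
  unfold position
  rw [map_mul, PresentedGroup.toGroup.of]
  rfl

theorem position_gB_mul (h : (r * u - s * t) ^ 2 = 1) (g : SapphireGroup r s t u) :
    position h (gB r s t u * g) = permA₂ h (position h g) := by
  unfold position
  rw [map_mul, PresentedGroup.toGroup.of]
  rfl

theorem rel_one : gA r s t u * gY r s t u * (gA r s t u)⁻¹ = (gY r s t u)⁻¹ := by
  have h := PresentedGroup.one_of_mem (rels := relators r s t u) (Or.inl rfl)
  rw [map_mul, map_inv, mul_inv_eq_one] at h
  simp only [map_mul, map_inv] at h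
  exact h

theorem rel_two : gB r s t u * gB r s t u = gX r s t u ^ r * gY r s t u ^ s := by
  have h := PresentedGroup.one_of_mem (rels := relators r s t u) (Or.inr (Or.inl rfl))
  rw [map_mul, map_inv, mul_inv_eq_one] at h
  simp only [map_mul, map_zpow, pow_two, zpow_mul, zpow_ofNat] at h
  exact h

theorem rel_three : gB r s t u * (gX r s t u ^ t * gY r s t u ^ u) * (gB r s t u)⁻¹ =
    (gX r s t u ^ t * gY r s t u ^ u)⁻¹ := by
  have h := PresentedGroup.one_of_mem (rels := relators r s t u) (Or.inr (Or.inr rfl))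
  rw [map_mul, map_inv, mul_inv_eq_one] at h
  simp only [map_mul, map_inv, map_zpow, zpow_neg, zpow_mul, zpow_ofNat, pow_two] at h
  rw [mul_inv_rev, ← mul_assoc]
  exact h

/-! ### The torus subgroup -/

theorem commute_gX_gY : Commute (gX r s t u) (gY r s t u) := by
  have h : SemiconjBy (gA r s t u) (gY r s t u) (gY r s t u)⁻¹ := by
    exact eq_mul_of_mul_inv_eq rel_one
  have h' := h.inv_right
  rw [inv_inv] at h'
  exact h'.mul_left h

variable (r s t u) in
/-- The subgroup `⟨a₁², b₁⟩`, the fundamental group of the torus along which the two twisted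
`I`-bundles over the Klein bottle are glued. -/
def torus : Subgroup (SapphireGroup r s t u) :=
  Subgroup.zpowers (gY r s t u) ⊔ Subgroup.zpowers (gX r s t u)

theorem gY_mem : gY r s t u ∈ torus r s t u :=
  (le_sup_left : _ ≤ torus r s t u) (Subgroup.mem_zpowers _)

theorem gX_mem : gX r s t u ∈ torus r s t u :=
  (le_sup_right : _ ≤ torus r s t u) (Subgroup.mem_zpowers _)

theorem gB_mul_gB_mem : gB r s t u * gB r s t u ∈ torus r s t u := by
  rw [rel_two]
  exact mul_mem (zpow_mem gX_mem _) (zpow_mem gY_mem _)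

theorem mem_normalizer_torus {g : SapphireGroup r s t u} (hg : g * g ∈ torus r s t u)
    (hx : g * gX r s t u * g⁻¹ ∈ torus r s t u) (hy : g * gY r s t u * g⁻¹ ∈ torus r s t u) :
    g ∈ Subgroup.normalizer (torus r s t u : Set (SapphireGroup r s t u)) := by
  have h : torus r s t u ≤ (torus r s t u).comap (MulAut.conj g).toMonoidHom :=
    sup_le (Subgroup.zpowers_le.2 hy) (Subgroup.zpowers_le.2 hx)
  refine Subgroup.mem_normalizer_iff.2 fun n => ⟨fun hn => h hn, fun hn => ?_⟩
  have h1 : g * (g * n * g⁻¹) * g⁻¹ ∈ torus r s t u := h hn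
  have h2 := mul_mem (mul_mem (inv_mem hg) h1) hg
  rwa [show (g * g)⁻¹ * (g * (g * n * g⁻¹) * g⁻¹) * (g * g) = n by group] at h2

theorem closure_generators :
    Subgroup.closure {gA r s t u, gY r s t u, gB r s t u} = ⊤ := by
  rw [← PresentedGroup.closure_range_of]
  congr 1
  ext g
  simp [Fin.exists_fin_succ, eq_comm]

theorem torus_normal (h : (r * u - s * t) ^ 2 = 1) : (torus r s t u).Normal := by
  rw [← Subgroup.normalizer_eq_top_iff, ← top_le_iff, ← closure_generators, Subgroup.closure_le]
  have c := commute_gX_gY (r := r) (s := s) (t := t) (u := u)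
  have e : ∀ m n m' n' i j : ℤ, (gX r s t u ^ m * gY r s t u ^ n) ^ i *
      (gX r s t u ^ m' * gY r s t u ^ n') ^ j =
      gX r s t u ^ (m * i + m' * j) * gY r s t u ^ (n * i + n' * j) := by
    intro m n m' n' i j
    rw [(c.zpow_zpow _ _).mul_zpow, (c.zpow_zpow _ _).mul_zpow, ← zpow_mul, ← zpow_mul,
      ← zpow_mul, ← zpow_mul, zpow_add, zpow_add, mul_assoc, ← mul_assoc (gY r s t u ^ (n * i)),
      (c.zpow_zpow _ _).symm.eq]
    simp only [mul_assoc]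
  -- The torus group is also generated by `a₂²` and `a₁²ᵗ b₁ᵘ`, on which `a₂` acts by the relations.
  have hb : ∀ i j : ℤ, gB r s t u * ((gX r s t u ^ r * gY r s t u ^ s) ^ i *
      (gX r s t u ^ t * gY r s t u ^ u) ^ j) * (gB r s t u)⁻¹ ∈ torus r s t u := by
    intro i j
    rw [← conj_mul, ← conj_zpow, ← conj_zpow, rel_three, ← rel_two,
      show ∀ g : SapphireGroup r s t u, g * (g * g) * g⁻¹ = g * g from fun g => by group]
    exact mul_mem (zpow_mem gB_mul_gB_mem _) (zpow_mem (inv_mem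
      (mul_mem (zpow_mem gX_mem _) (zpow_mem gY_mem _))) _)
  rintro g (rfl | rfl | rfl)
  · refine mem_normalizer_torus gX_mem ?_ ?_
    · rw [mul_assoc, mul_assoc, mul_inv_cancel, mul_one]
      exact gX_mem
    · rw [rel_one]
      exact inv_mem gY_mem
  · exact Subgroup.le_normalizer gY_mem
  · refine mem_normalizer_torus gB_mul_gB_mem ?_ ?_
    · have h1 := hb (u * (r * u - s * t)) (-s * (r * u - s * t))
      rw [e, show r * (u * (r * u - s * t)) + t * (-s * (r * u - s * t)) = 1 by
        linear_combination h, show s * (u * (r * u - s * t)) + u * (-s * (r * u - s * t)) = 0 by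
        ring, zpow_one, zpow_zero, mul_one] at h1
      exact h1
    · have h1 := hb (-t * (r * u - s * t)) (r * (r * u - s * t))
      rw [e, show r * (-t * (r * u - s * t)) + t * (r * (r * u - s * t)) = 0 by
        ring, show s * (-t * (r * u - s * t)) + u * (r * (r * u - s * t)) = 1 by
        linear_combination h, zpow_one, zpow_zero, one_mul] at h1
      exact h1

theorem torus_sup_sup_eq_top : torus r s t u ⊔ Subgroup.zpowers (gA r s t u) ⊔
    Subgroup.zpowers (gB r s t u) = ⊤ := by
  rw [← top_le_iff, ← closure_generators, Subgroup.closure_le]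
  rintro g (rfl | rfl | rfl)
  · exact (le_sup_right.trans le_sup_left : Subgroup.zpowers (gA r s t u) ≤ _)
      (Subgroup.mem_zpowers _)
  · exact (le_sup_left.trans le_sup_left : torus r s t u ≤ _) gY_mem
  · exact (le_sup_right : Subgroup.zpowers (gB r s t u) ≤ _) (Subgroup.mem_zpowers _)

/-! ### Heights and coordinates -/

/-- A function invariant under left multiplication by the generators of the torus group is invariant
under the torus group. -/
theorem apply_torus_mul {T : Type*} {f : SapphireGroup r s t u → T}
    (hx : ∀ g, f (gX r s t u * g) = f g) (hy : ∀ g, f (gY r s t u * g) = f g) :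
    ∀ n ∈ torus r s t u, ∀ g, f (n * g) = f g := by
  let S : Subgroup (SapphireGroup r s t u) :=
    { carrier := {n | ∀ g, f (n * g) = f g}
      mul_mem' := fun {m n} hm hn g => by rw [mul_assoc, hm, hn]
      one_mem' := fun g => by rw [one_mul]
      inv_mem' := fun {m} hm g => by
        have := hm (m⁻¹ * g)
        rw [mul_inv_cancel_left] at this
        exact this.symm }
  have h : torus r s t u ≤ S := sup_le (Subgroup.zpowers_le.2 hy) (Subgroup.zpowers_le.2 hx)
  exact fun n hn => h hn

/-- The height along `a₁²`. -/
def heightX (h : (r * u - s * t) ^ 2 = 1) (g : SapphireGroup r s t u) : ℤ := (position h g).1 / 2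

/-- The height along `b₁`. -/
def heightY (h : (r * u - s * t) ^ 2 = 1) (g : SapphireGroup r s t u) : ℤ := (position h g).2.1 / 2

/-- The height along `a₂ a₁`, which moves the chain of edges by two. -/
def heightZ (h : (r * u - s * t) ^ 2 = 1) (g : SapphireGroup r s t u) : ℤ := (position h g).2.2 / 2

variable (h : (r * u - s * t) ^ 2 = 1)

theorem heightY_gY_mul (g : SapphireGroup r s t u) :
    heightY h (gY r s t u * g) = heightY h g + 1 := by
  unfold heightY
  rw [position_gY_mul]
  simp only [permB₁, Equiv.coe_fn_mk]
  omega

theorem heightX_gY_mul (g : SapphireGroup r s t u) :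
    heightX h (gY r s t u * g) = heightX h g := by
  unfold heightX
  rw [position_gY_mul]
  rfl

theorem heightX_gX_mul (g : SapphireGroup r s t u) :
    heightX h (gX r s t u * g) = heightX h g + 1 := by
  unfold heightX
  rw [mul_assoc, position_gA_mul, position_gA_mul]
  simp only [permA₁, Equiv.coe_fn_mk]
  omega

theorem heightZ_torus_mul : ∀ n ∈ torus r s t u, ∀ g, heightZ h (n * g) = heightZ h g := by
  refine apply_torus_mul (fun g => ?_) (fun g => ?_)
  · unfold heightZ
    rw [mul_assoc, position_gA_mul, position_gA_mul]
    simp only [permA₁, Equiv.coe_fn_mk]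
    omega
  · unfold heightZ
    rw [position_gY_mul]
    rfl

theorem heightZ_gB_mul_gA_mul (g : SapphireGroup r s t u) :
    heightZ h (gB r s t u * gA r s t u * g) = heightZ h g + 1 := by
  unfold heightZ
  rw [mul_assoc, position_gB_mul, position_gA_mul]
  simp only [permA₁, permA₂, Equiv.coe_fn_mk]
  omega

section Coordinates

variable (k : Type) [CommRing k] [Invertible (2 : k)]

/-- The first plane coordinate, normalised to increase by `1` under `a₁²`. -/
def coordX (g : SapphireGroup r s t u) : k := ⅟2 * ((position h g).1 : k)

/-- The second plane coordinate, normalised to increase by `1` under `b₁`. -/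
def coordY (g : SapphireGroup r s t u) : k := ⅟2 * ((position h g).2.1 : k)

theorem coordX_gA_mul (g : SapphireGroup r s t u) :
    coordX h k (gA r s t u * g) = coordX h k g + ⅟2 := by
  unfold coordX
  rw [position_gA_mul]
  simp only [permA₁, Equiv.coe_fn_mk]
  push_cast
  ring

theorem coordY_gA_mul (g : SapphireGroup r s t u) :
    coordY h k (gA r s t u * g) = -coordY h k g := by
  unfold coordY
  rw [position_gA_mul]
  simp only [permA₁, Equiv.coe_fn_mk]
  push_cast
  ring

theorem coordX_gY_mul (g : SapphireGroup r s t u) :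
    coordX h k (gY r s t u * g) = coordX h k g := by
  unfold coordX
  rw [position_gY_mul]
  rfl

theorem coordY_gY_mul (g : SapphireGroup r s t u) :
    coordY h k (gY r s t u * g) = coordY h k g + 1 := by
  unfold coordY
  rw [position_gY_mul]
  simp only [permB₁, Equiv.coe_fn_mk]
  push_cast
  linear_combination invOf_mul_self (2 : k)

theorem coordX_gX_mul (g : SapphireGroup r s t u) :
    coordX h k (gX r s t u * g) = coordX h k g + 1 := by
  rw [mul_assoc, coordX_gA_mul, coordX_gA_mul]
  linear_combination invOf_mul_self (2 : k)

theorem coordY_gX_mul (g : SapphireGroup r s t u) :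
    coordY h k (gX r s t u * g) = coordY h k g := by
  rw [mul_assoc, coordY_gA_mul, coordY_gA_mul, neg_neg]

theorem coordX_gB_mul (g : SapphireGroup r s t u) :
    coordX h k (gB r s t u * g) =
      reflFst (r : k) s t u (coordX h k g) (coordY h k g) + ⅟2 * r := by
  unfold coordX coordY
  rw [position_gB_mul]
  simp only [permA₂, Equiv.coe_fn_mk, reflFst]
  push_cast
  ring

theorem coordY_gB_mul (g : SapphireGroup r s t u) :
    coordY h k (gB r s t u * g) =
      reflSnd (r : k) s t u (coordX h k g) (coordY h k g) + ⅟2 * s := by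
  unfold coordX coordY
  rw [position_gB_mul]
  simp only [permA₂, Equiv.coe_fn_mk, reflSnd]
  push_cast
  ring

end Coordinates

end Action

end Sapphire

namespace GroupCohomologyRing

universe u

variable {k G : Type u} [CommRing k] [Group G]

/-! ### Homogeneous cocycles of degree one -/

theorem eq_contract_sub {F : HCochain k G 2} (hF : hcobd F = 0) (γ : Fin 2 → G) :
    F γ = F ![1, γ 1] - F ![1, γ 0] := by
  have h1 := congrFun (hcobd_contract hF) γ
  rw [← h1]
  have e : ∀ δ : Fin 1 → G, (Fin.cons 1 δ : Fin 2 → G) = ![1, δ 0] := by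
    intro δ
    funext i
    fin_cases i <;> simp
  change contract F (Fin.tail γ) - contract F (Fin.cons (γ 0) _) = _
  simp only [contract, e]
  rfl

/-- A cocycle of degree one fixed by `g` is additive for products with left factor `g`. -/
theorem apply_one_mul {F : HCochain k G 2} (hF : hcobd F = 0) {g : G} (hg : leftTranslate g F = F)
    (h : G) : F ![1, g * h] = F ![1, g] + F ![1, h] := by
  have h1 := congrFun hg ![1, h]
  rw [leftTranslate_apply, eq_contract_sub hF] at h1
  simp only [Pi.smul_apply, Matrix.cons_val_zero, Matrix.cons_val_one, smul_eq_mul, mul_one] at h1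
  linear_combination h1

/-- The restriction of a cocycle of degree one to its fixer. -/
def restrictHom {F : HCochain k G 2} (hF : hcobd F = 0) : fixer F →* Multiplicative k :=
  MonoidHom.mk' (fun g => Multiplicative.ofAdd (F ![1, (g : G)]))
    (fun g h => apply_one_mul hF g.2 (h : G))

theorem apply_one_zpow {F : HCochain k G 2} (hF : hcobd F = 0) {g : G} (hg : leftTranslate g F = F)
    (n : ℤ) : F ![1, g ^ n] = n * F ![1, g] := by
  have h1 := congrArg Multiplicative.toAdd (map_zpow (restrictHom hF) ⟨g, hg⟩ n)
  rw [toAdd_zpow, zsmul_eq_mul] at h1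
  exact h1

/-- A cocycle of degree one vanishes on elements conjugate to their inverses. -/
theorem apply_one_eq_zero [Invertible (2 : k)] {F : HCochain k G 2} (hF : hcobd F = 0) {g n : G}
    (hg : leftTranslate g F = F) (hn : leftTranslate n F = F) (e : g * n * g⁻¹ = n⁻¹) :
    F ![1, n] = 0 := by
  have h1 := apply_one_mul hF hg n
  have h2 := apply_one_mul hF hn (g * n)
  have h3 : n * (g * n) = g := by
    rw [mul_inv_eq_iff_eq_mul] at e
    rw [e, mul_inv_cancel_left]
  rw [h3, h1] at h2
  have h4 : 2 * F ![1, n] = 0 := by linear_combination -h2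
  rw [← invOf_mul_cancel_left (2 : k) (F ![1, n]), h4, mul_zero]

end GroupCohomologyRing

namespace Sapphire

open GroupCohomologyRing

variable {r s t u : ℤ} {k : Type} [CommRing k]

local notation "Γ" => SapphireGroup r s t u
local notation "T" => torus r s t u
local notation "ga" => gA r s t u
local notation "gx" => gX r s t u
local notation "gy" => gY r s t u
local notation "gb" => gB r s t u

/-! ### Cohomology of the torus subgroup -/

theorem acyclic_zpowers_gY (h : (r * u - s * t) ^ 2 = 1) (n : ℕ) :
    Acyclic k (Subgroup.zpowers gy) (n + 2) := by
  have h1 := Acyclic.sup_zpowers (k := k) (S := (⊥ : Subgroup Γ)) (τ := gy)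
    (by rw [Subgroup.normalizer_eq_top]; trivial) (heightY h)
    (fun s hs g => by rw [Subgroup.mem_bot.1 hs, one_mul]) (heightY_gY_mul h)
    (acyclic_bot (n + 1)) (acyclic_bot (n + 2))
  rwa [bot_sup_eq] at h1

theorem gX_mem_normalizer : gx ∈ Subgroup.normalizer (Subgroup.zpowers gy : Set Γ) := by
  refine Subgroup.mem_normalizer_iff.2 fun n => ?_
  have h1 : ∀ n ∈ Subgroup.zpowers gy, gx * n * gx⁻¹ = n := by
    rintro _ ⟨i, rfl⟩
    exact mul_inv_eq_iff_eq_mul.2 (commute_gX_gY.zpow_right i).eq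
  refine ⟨fun hn => by rwa [h1 n hn], fun hn => ?_⟩
  have h2 := h1 _ hn
  rw [mul_left_inj, mul_right_inj] at h2
  rwa [h2] at hn

theorem heightX_zpowers_mul (h : (r * u - s * t) ^ 2 = 1) :
    ∀ n ∈ Subgroup.zpowers gy, ∀ g : Γ, heightX h (n * g) = heightX h g := by
  rintro _ ⟨i, rfl⟩
  induction i with
  | zero => simp
  | succ i ih =>
    intro g
    simp only [zpow_add_one, mul_assoc] at ih ⊢
    rw [ih, heightX_gY_mul]
  | pred i ih =>
    intro g
    have h1 := heightX_gY_mul h (gy⁻¹ * g)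
    rw [mul_inv_cancel_left] at h1
    simp only [zpow_sub_one, mul_assoc] at ih ⊢
    rw [ih, h1]

theorem acyclic_torus (h : (r * u - s * t) ^ 2 = 1) (n : ℕ) : Acyclic k T (n + 3) :=
  Acyclic.sup_zpowers gX_mem_normalizer (heightX h) (heightX_zpowers_mul h) (heightX_gX_mul h)
    (acyclic_zpowers_gY h n) (acyclic_zpowers_gY h (n + 1))

theorem exists_primitive_one {F : HCochain k Γ 2} (hF : F ∈ invariants k T 2)
    (dF : hcobd F = 0) (hx : F ![1, gx] = 0) (hy : F ![1, gy] = 0) :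
    ∃ v ∈ invariants k T 1, hcobd v = F :=
  ⟨contract F, mem_invariants_sup_zpowers.2 ⟨mem_invariants_zpowers.2
    (leftTranslate_contract dF (leftTranslate_eq hF gY_mem) hy),
    leftTranslate_contract dF (leftTranslate_eq hF gX_mem) hx⟩, hcobd_contract dF⟩

/-- Evaluation of a cochain on the fundamental cycle of the torus. -/
def evTorus (F : HCochain k Γ 3) : k := F ![1, gx, gx * gy] - F ![1, gy, gx * gy]

theorem evTorus_sub (F F' : HCochain k Γ 3) : evTorus (F - F') = evTorus F - evTorus F' := by
  simp only [evTorus, Pi.sub_apply]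
  ring

theorem evTorus_smul (c : k) (F : HCochain k Γ 3) : evTorus (c • F) = c * evTorus F := by
  simp only [evTorus, Pi.smul_apply, smul_eq_mul]
  ring

theorem hcobd_apply_three {G : Type} [Group G] (v : HCochain k G 2) (g₀ g₁ g₂ : G) :
    hcobd v ![g₀, g₁, g₂] = v ![g₁, g₂] - v ![g₀, g₂] + v ![g₀, g₁] := by
  rw [hcobd_eq_sum, Fin.sum_univ_three]
  have e1 : (fun i => (![g₀, g₁, g₂] : Fin 3 → G) ((0 : Fin 3).succAbove i)) = ![g₁, g₂] := by
    funext i; fin_cases i <;> simp [Fin.succAbove]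
  have e2 : (fun i => (![g₀, g₁, g₂] : Fin 3 → G) ((1 : Fin 3).succAbove i)) = ![g₀, g₂] := by
    funext i; fin_cases i <;> simp [Fin.succAbove]
  have e3 : (fun i => (![g₀, g₁, g₂] : Fin 3 → G) ((2 : Fin 3).succAbove i)) = ![g₀, g₁] := by
    funext i; fin_cases i <;> simp [Fin.succAbove]
  rw [e1, e2, e3]
  simp
  ring

theorem smul_pair {G : Type} [Group G] (g g₀ g₁ : G) :
    g • (![g₀, g₁] : Fin 2 → G) = ![g * g₀, g * g₁] := by
  funext i; fin_cases i <;> rfl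

theorem apply_gX {v : HCochain k Γ 2} (hv : leftTranslate gx v = v) :
    v ![gx, gx * gy] = v ![1, gy] := by
  have h1 := congrFun hv ![1, gy]
  rwa [leftTranslate_apply, smul_pair, mul_one] at h1

theorem apply_gY {v : HCochain k Γ 2} (hv : leftTranslate gy v = v) :
    v ![gy, gx * gy] = v ![1, gx] := by
  have h1 := congrFun hv ![1, gx]
  rwa [leftTranslate_apply, smul_pair, mul_one, ← commute_gX_gY.eq] at h1

theorem evTorus_hcobd {v : HCochain k Γ 2} (hv : v ∈ invariants k T 2) :
    evTorus (hcobd v) = 0 := by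
  rw [evTorus, hcobd_apply_three, hcobd_apply_three, apply_gX (leftTranslate_eq hv gX_mem),
    apply_gY (leftTranslate_eq hv gY_mem)]
  ring

/-- A cocycle of degree two on the torus subgroup that vanishes on the fundamental cycle is a
coboundary. -/
theorem exists_primitive_two (h : (r * u - s * t) ^ 2 = 1) {F : HCochain k Γ 3}
    (hF : F ∈ invariants k T 3) (dF : hcobd F = 0) (e : evTorus F = 0) :
    ∃ v ∈ invariants k T 2, hcobd v = F := by
  obtain ⟨hFy, hFx⟩ := mem_invariants_sup_zpowers.1 hF
  obtain ⟨v, hv, rfl⟩ := acyclic_zpowers_gY h 0 F hFy dF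
  have hn := gX_mem_normalizer (r := r) (s := s) (t := t) (u := u)
  have hw : leftTranslate gx v - v ∈ invariants k (Subgroup.zpowers gy) 2 :=
    sub_mem (leftTranslate_mem (fun s hs => (Subgroup.mem_normalizer_iff.1 hn s).1 hs) hv) hv
  have dw : hcobd (leftTranslate gx v - v) = 0 := by
    rw [map_sub, hcobd_translate, hFx, sub_self]
  have ew : (leftTranslate gx v - v) ![1, gy] = 0 := by
    rw [evTorus, hcobd_apply_three, hcobd_apply_three, apply_gY (mem_invariants_zpowers.1 hv)] at e
    rw [Pi.sub_apply, leftTranslate_apply, smul_pair, mul_one]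
    linear_combination e
  obtain ⟨f, hf, ef⟩ := exists_translate_sub_eq hn (heightX h) (heightX_zpowers_mul h)
    (heightX_gX_mul h) (mem_invariants_zpowers.2
      (leftTranslate_contract dw (mem_invariants_zpowers.1 hw) ew))
  have ef' := congrArg hcobd ef
  rw [hcobd_contract dw, map_sub, hcobd_translate] at ef'
  refine ⟨v - hcobd f, mem_invariants_sup_zpowers.2 ⟨sub_mem hv (hcobd_mem hf), ?_⟩, ?_⟩
  · rw [map_sub]
    linear_combination -ef'
  · rw [map_sub, hcobd_hcobd, sub_zero]

/-! ### The classes of the torus subgroup and the action of the generators -/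

section Reflections

variable [Invertible (2 : k)] (h : (r * u - s * t) ^ 2 = 1)

theorem mulDiff_apply_three (X : Γ → k) (F : HCochain k Γ 2) (g₀ g₁ g₂ : Γ) :
    mulDiff X F ![g₀, g₁, g₂] = (X g₁ - X g₀) * F ![g₁, g₂] := rfl

theorem evTorus_mulDiff {X : Γ → k} {p q : k} (hx : ∀ g, X (gx * g) = X g + p)
    (hy : ∀ g, X (gy * g) = X g + q) {F : HCochain k Γ 2} (hF : F ∈ invariants k T 2) :
    evTorus (mulDiff X F) = p * F ![1, gy] - q * F ![1, gx] := by
  rw [evTorus, mulDiff_apply_three, mulDiff_apply_three, apply_gX (leftTranslate_eq hF gX_mem),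
    apply_gY (leftTranslate_eq hF gY_mem)]
  have h1 := hx 1
  have h2 := hy 1
  rw [mul_one] at h1 h2
  rw [h1, h2]
  ring

theorem diff_mem {X : Γ → k} {p q : k} (hx : ∀ g, X (gx * g) = X g + p)
    (hy : ∀ g, X (gy * g) = X g + q) : diff X ∈ invariants k T 2 :=
  mem_invariants_sup_zpowers.2 ⟨mem_invariants_zpowers.2 (leftTranslate_diff hy),
    leftTranslate_diff hx⟩

theorem diff_apply_gX {X : Γ → k} {p : k} (hx : ∀ g, X (gx * g) = X g + p) :
    diff X ![1, gx] = p := by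
  have h1 := hx 1
  rw [mul_one] at h1
  exact sub_eq_iff_eq_add'.2 h1

theorem diff_apply_gY {X : Γ → k} {q : k} (hy : ∀ g, X (gy * g) = X g + q) :
    diff X ![1, gy] = q := by
  have h1 := hy 1
  rw [mul_one] at h1
  exact sub_eq_iff_eq_add'.2 h1

theorem mulDiff_mem {X : Γ → k} {p q : k} (hx : ∀ g, X (gx * g) = X g + p)
    (hy : ∀ g, X (gy * g) = X g + q) {n : ℕ} {F : HCochain k Γ (n + 1)}
    (hF : F ∈ invariants k T (n + 1)) : mulDiff X F ∈ invariants k T (n + 2) := by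
  refine mem_invariants_sup_zpowers.2 ⟨mem_invariants_zpowers.2 ?_, ?_⟩
  · rw [leftTranslate_mulDiff hy, leftTranslate_eq hF gY_mem]
  · rw [leftTranslate_mulDiff hx, leftTranslate_eq hF gX_mem]

theorem coordX_gY_mul' (g : Γ) : coordX h k (gy * g) = coordX h k g + 0 := by
  rw [coordX_gY_mul, add_zero]

theorem coordY_gX_mul' (g : Γ) : coordY h k (gx * g) = coordY h k g + 0 := by
  rw [coordY_gX_mul, add_zero]

variable (k) in
/-- The cocycle of degree two `dX ⌣ dY`, whose value on the fundamental cycle of the torus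
is `1`. -/
def areaCocycle : HCochain k Γ 3 := mulDiff (coordX h k) (diff (coordY h k))

theorem diff_coordX_mem : diff (coordX h k) ∈ invariants k T 2 :=
  diff_mem (coordX_gX_mul h k) (coordX_gY_mul' h)

theorem diff_coordY_mem : diff (coordY h k) ∈ invariants k T 2 :=
  diff_mem (coordY_gX_mul' h) (coordY_gY_mul h k)

theorem areaCocycle_mem : areaCocycle k h ∈ invariants k T 3 :=
  mulDiff_mem (coordX_gX_mul h k) (coordX_gY_mul' h) (diff_coordY_mem h)

theorem hcobd_areaCocycle : hcobd (areaCocycle k h) = 0 := by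
  rw [areaCocycle, hcobd_mulDiff, hcobd_diff]
  funext γ
  simp [mulDiff]

theorem evTorus_areaCocycle : evTorus (areaCocycle k h) = 1 := by
  rw [areaCocycle, evTorus_mulDiff (coordX_gX_mul h k) (coordX_gY_mul' h) (diff_coordY_mem h),
    diff_apply_gY (coordY_gY_mul h k)]
  ring

/-- A cocycle on the torus fixed by an orientation-reversing element vanishes on the fundamental
cycle. -/
theorem evTorus_eq_zero {g : Γ} (hg : evTorus (leftTranslate g (areaCocycle k h)) = -1)
    {F : HCochain k Γ 3} (hF : F ∈ invariants k T 3) (dF : hcobd F = 0)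
    (e : leftTranslate g F = F) : evTorus F = 0 := by
  have := torus_normal h
  obtain ⟨v, hv, ev⟩ := exists_primitive_two h
    (sub_mem hF (Submodule.smul_mem _ (evTorus F) (areaCocycle_mem h)))
    (by rw [map_sub, map_smul, dF, hcobd_areaCocycle, smul_zero, sub_zero])
    (by rw [evTorus_sub, evTorus_smul, evTorus_areaCocycle, mul_one, sub_self])
  have h1 : evTorus (leftTranslate g (F - evTorus F • areaCocycle k h)) = 0 := by
    rw [← ev, ← hcobd_translate, evTorus_hcobd (leftTranslate_mem_of_normal g hv)]
  rw [map_sub, map_smul, e, evTorus_sub, evTorus_smul, hg] at h1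
  have h2 : 2 * evTorus F = 0 := by linear_combination h1
  rw [← invOf_mul_cancel_left (2 : k) (evTorus F), h2, mul_zero]

theorem evTorus_translate_gA : evTorus (leftTranslate ga (areaCocycle k h)) = -1 := by
  have e1 : ∀ g : Γ, coordY h k (ga * g) = (-coordY h k) g + 0 := fun g => by
    rw [coordY_gA_mul, add_zero, Pi.neg_apply]
  have e2 : ∀ g : Γ, (-coordY h k) (gx * g) = (-coordY h k) g + 0 := fun g => by
    rw [Pi.neg_apply, coordY_gX_mul, add_zero, Pi.neg_apply]
  have e3 : ∀ g : Γ, (-coordY h k) (gy * g) = (-coordY h k) g + -1 := fun g => by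
    rw [Pi.neg_apply, coordY_gY_mul, Pi.neg_apply]
    ring
  rw [areaCocycle, leftTranslate_mulDiff (coordX_gA_mul h k), leftTranslate_diff e1,
    evTorus_mulDiff (coordX_gX_mul h k) (coordX_gY_mul' h) (diff_mem e2 e3), diff_apply_gY e3]
  ring

theorem evTorus_translate_gB : evTorus (leftTranslate gb (areaCocycle k h)) = -1 := by
  let X' : Γ → k := fun g => reflFst (r : k) s t u (coordX h k g) (coordY h k g)
  let Y' : Γ → k := fun g => reflSnd (r : k) s t u (coordX h k g) (coordY h k g)
  have x1 : ∀ g, X' (gx * g) = X' g + (r * u - s * t) * (r * u + s * t) := fun g => by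
    simp only [X', reflFst, coordX_gX_mul, coordY_gX_mul]
    ring
  have x2 : ∀ g, X' (gy * g) = X' g + (r * u - s * t) * (-2 * r * t) := fun g => by
    simp only [X', reflFst, coordX_gY_mul, coordY_gY_mul]
    ring
  have y1 : ∀ g, Y' (gx * g) = Y' g + (r * u - s * t) * (2 * s * u) := fun g => by
    simp only [Y', reflSnd, coordX_gX_mul, coordY_gX_mul]
    ring
  have y2 : ∀ g, Y' (gy * g) = Y' g + (r * u - s * t) * (-(r * u + s * t)) := fun g => by
    simp only [Y', reflSnd, coordX_gY_mul, coordY_gY_mul]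
    ring
  have hk : ((r : k) * u - s * t) ^ 2 = 1 := by exact_mod_cast congrArg (Int.cast : ℤ → k) h
  rw [areaCocycle, leftTranslate_mulDiff (X' := X') (coordX_gB_mul h k),
    leftTranslate_diff (X' := Y') (coordY_gB_mul h k), evTorus_mulDiff x1 x2 (diff_mem y1 y2),
    diff_apply_gX y1, diff_apply_gY y2]
  linear_combination (-((r : k) * u - s * t) ^ 2 - 1) * hk

/-- The linear combination `u X - t Y` of the coordinates, which vanishes on the class of
`a₁²ᵗ b₁ᵘ` and is fixed by `a₂`. -/
theorem leftTranslate_gB_diff :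
    leftTranslate gb ((u : k) • diff (coordX h k) - (t : k) • diff (coordY h k)) =
    (u : k) • diff (coordX h k) - (t : k) • diff (coordY h k) := by
  funext γ
  have hk : ((r : k) * u - s * t) ^ 2 = 1 := by exact_mod_cast congrArg (Int.cast : ℤ → k) h
  change (u : k) * (coordX h k (gb * γ 1) - coordX h k (gb * γ 0)) -
    (t : k) * (coordY h k (gb * γ 1) - coordY h k (gb * γ 0)) =
    (u : k) * (coordX h k (γ 1) - coordX h k (γ 0)) -
    (t : k) * (coordY h k (γ 1) - coordY h k (γ 0))
  simp only [coordX_gB_mul, coordY_gB_mul, reflFst, reflSnd]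
  linear_combination (u * (coordX h k (γ 1) - coordX h k (γ 0)) -
    (t : k) * (coordY h k (γ 1) - coordY h k (γ 0))) * hk

theorem leftTranslate_gA_diff : leftTranslate ga (diff (coordX h k)) = diff (coordX h k) :=
  leftTranslate_diff (coordX_gA_mul h k)

end Reflections

/-! ### The Mayer–Vietoris argument for the sapphire group -/

section Gluing

variable [Invertible (2 : k)]

theorem mem_invariants_top {n : ℕ} {F : HCochain k Γ n} :
    F ∈ invariants k (⊤ : Subgroup Γ) n ↔
      F ∈ invariants k T n ∧ leftTranslate ga F = F ∧ leftTranslate gb F = F := by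
  rw [← torus_sup_sup_eq_top, mem_invariants_sup_zpowers, mem_invariants_sup_zpowers, and_assoc]

/-- An invariant cochain bounding on the torus bounds on both Klein bottle groups. -/
theorem exists_primitives (h : (r * u - s * t) ^ 2 = 1)
    {n : ℕ} {v : HCochain k Γ n} (hv : v ∈ invariants k T n)
    (hz : hcobd v ∈ invariants k (⊤ : Subgroup Γ) (n + 1)) :
    ∃ v₁ ∈ invariants k T n, ∃ v₂ ∈ invariants k T n, leftTranslate ga v₁ = v₁ ∧
      leftTranslate gb v₂ = v₂ ∧ hcobd v₁ = hcobd v ∧ hcobd v₂ = hcobd v := by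
  have := torus_normal h
  obtain ⟨-, ha, hb⟩ := mem_invariants_top.1 hz
  obtain ⟨v₁, hv₁, h₁, e₁⟩ := exists_average gX_mem hv ha
  obtain ⟨v₂, hv₂, h₂, e₂⟩ := exists_average gB_mul_gB_mem hv hb
  exact ⟨v₁, hv₁, v₂, hv₂, h₁, h₂, e₁, e₂⟩

/-- Surjectivity of the difference map from cochains invariant under the two Klein bottle groups to
cochains invariant under the torus group. -/
theorem exists_split (h : (r * u - s * t) ^ 2 = 1)
    {n : ℕ} {φ : HCochain k Γ (n + 1)} (hφ : φ ∈ invariants k T (n + 1)) :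
    ∃ φ₁ ∈ invariants k T (n + 1), ∃ φ₂ ∈ invariants k T (n + 1),
      leftTranslate ga φ₁ = φ₁ ∧ leftTranslate gb φ₂ = φ₂ ∧ φ₁ - φ₂ = φ := by
  have := torus_normal h
  exact exists_sub_eq gX_mem gB_mul_gB_mem (heightZ h) (heightZ_torus_mul h)
    (heightZ_gB_mul_gA_mul h) hφ

/-- Primitives on the two Klein bottle groups glue if their difference bounds on the torus. -/
theorem exists_invariant_primitive (h : (r * u - s * t) ^ 2 = 1)
    {n : ℕ} {v₁ v₂ : HCochain k Γ (n + 2)}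
    (hv₁ : v₁ ∈ invariants k T (n + 2)) (ha : leftTranslate ga v₁ = v₁)
    (hb : leftTranslate gb v₂ = v₂) {w : HCochain k Γ (n + 1)} (hw : w ∈ invariants k T (n + 1))
    (e : v₁ - v₂ = hcobd w) :
    ∃ v ∈ invariants k (⊤ : Subgroup Γ) (n + 2), hcobd v = hcobd v₁ := by
  have := torus_normal h
  exact exists_glue gX_mem gB_mul_gB_mem (heightZ h) (heightZ_torus_mul h)
    (heightZ_gB_mul_gA_mul h) torus_sup_sup_eq_top hv₁ ha hb hw e

/-- The connecting map of the Mayer–Vietoris sequence, applied to the torus cocycle `φ₁ - φ₂`, takes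
values in invariant cocycles. -/
theorem hcobd_mem_top {n : ℕ} {φ₁ φ₂ : HCochain k Γ n} (h₁ : φ₁ ∈ invariants k T n)
    (ha : leftTranslate ga φ₁ = φ₁) (hb : leftTranslate gb φ₂ = φ₂)
    (e : hcobd φ₁ = hcobd φ₂) : hcobd φ₁ ∈ invariants k (⊤ : Subgroup Γ) (n + 1) := by
  refine mem_invariants_top.2 ⟨hcobd_mem h₁, ?_, ?_⟩
  · rw [← hcobd_translate, ha]
  · rw [e, ← hcobd_translate, hb]

theorem acyclic_top (h : (r * u - s * t) ^ 2 = 1) (n : ℕ) : Acyclic k (⊤ : Subgroup Γ) (n + 4) := by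
  intro z hz dz
  obtain ⟨v, hv, rfl⟩ := acyclic_torus h (n + 1) z (invariants_anti le_top hz) dz
  obtain ⟨v₁, hv₁, v₂, hv₂, ha, hb, e₁, e₂⟩ := exists_primitives h hv hz
  obtain ⟨w, hw, ew⟩ := acyclic_torus h n (v₁ - v₂) (sub_mem hv₁ hv₂)
    (by rw [map_sub, e₁, e₂, sub_self])
  rw [← e₁]
  exact exists_invariant_primitive h hv₁ ha hb hw ew.symm

/-! ### The sapphire group in degree three -/

theorem exists_primitive_three (h : (r * u - s * t) ^ 2 = 1)
    {v₁ v₂ : HCochain k Γ 3} (hv₁ : v₁ ∈ invariants k T 3)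
    (hv₂ : v₂ ∈ invariants k T 3) (ha : leftTranslate ga v₁ = v₁) (hb : leftTranslate gb v₂ = v₂)
    (e : hcobd v₁ = hcobd v₂) (e' : evTorus (v₁ - v₂) = 0) :
    ∃ v ∈ invariants k (⊤ : Subgroup Γ) 3, hcobd v = hcobd v₁ := by
  obtain ⟨w, hw, ew⟩ := exists_primitive_two h (sub_mem hv₁ hv₂)
    (by rw [map_sub, e, sub_self]) e'
  exact exists_invariant_primitive h hv₁ ha hb hw ew.symm

/-- The value of `v₁ - v₂` on the fundamental cycle only depends on the class of
`hcobd v₁ = hcobd v₂`. -/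
theorem evTorus_sub_eq_zero (h : (r * u - s * t) ^ 2 = 1)
    {v v₁ v₂ : HCochain k Γ 3} (hv : v ∈ invariants k (⊤ : Subgroup Γ) 3)
    (hv₁ : v₁ ∈ invariants k T 3) (hv₂ : v₂ ∈ invariants k T 3) (ha : leftTranslate ga v₁ = v₁)
    (hb : leftTranslate gb v₂ = v₂) (e₁ : hcobd v₁ = hcobd v) (e₂ : hcobd v₂ = hcobd v) :
    evTorus (v₁ - v₂) = 0 := by
  obtain ⟨hT, hva, hvb⟩ := mem_invariants_top.1 hv
  have h1 := evTorus_eq_zero h (evTorus_translate_gA h) (sub_mem hv₁ hT)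
    (by rw [map_sub, e₁, sub_self]) (by rw [map_sub, ha, hva])
  have h2 := evTorus_eq_zero h (evTorus_translate_gB h) (sub_mem hv₂ hT)
    (by rw [map_sub, e₂, sub_self]) (by rw [map_sub, hb, hvb])
  rw [evTorus_sub] at h1 h2 ⊢
  linear_combination h1 - h2

/-- A class of degree three is a generator as soon as the associated cocycle on the torus takes an
invertible value on the fundamental cycle. -/
theorem span_cls_three [Nontrivial k] (h : (r * u - s * t) ^ 2 = 1)
    {f : Cochain k Γ 3} (hf : cobd f = 0)
    {v₁ v₂ : HCochain k Γ 3}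
    (hv₁ : v₁ ∈ invariants k T 3) (hv₂ : v₂ ∈ invariants k T 3) (ha : leftTranslate ga v₁ = v₁)
    (hb : leftTranslate gb v₂ = v₂) (e₁ : hcobd v₁ = homog f) (e₂ : hcobd v₂ = homog f)
    (hu : IsUnit (evTorus (v₁ - v₂))) :
    Submodule.span k {cls f hf} = ⊤ ∧ cls f hf ≠ 0 := by
  constructor
  · refine span_cls_eq_top hf fun z hz dz => ?_
    obtain ⟨w, hw, rfl⟩ := acyclic_torus h 0 z (invariants_anti le_top hz) dz
    obtain ⟨w₁, hw₁, w₂, hw₂, ha', hb', e₁', e₂'⟩ := exists_primitives h hw hz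
    obtain ⟨c, hc⟩ := hu.exists_right_inv
    let d := c * (evTorus w₁ - evTorus w₂)
    obtain ⟨v, hv, ev⟩ := exists_primitive_three h
      (sub_mem hw₁ (Submodule.smul_mem _ d hv₁)) (sub_mem hw₂ (Submodule.smul_mem _ d hv₂))
      (by rw [map_sub, map_smul, ha, ha']) (by rw [map_sub, map_smul, hb, hb'])
      (by rw [map_sub, map_sub, map_smul, map_smul, e₁, e₂, e₁', e₂'])
      (by
        simp only [evTorus_sub, evTorus_smul, d] at hc ⊢
        linear_combination -(evTorus w₁ - evTorus w₂) * hc)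
    exact ⟨d, v, hv, by rw [ev, map_sub, map_smul, e₁, e₁']⟩
  · intro h0
    obtain ⟨v, hv, ev⟩ := (cls_succ_eq_zero_iff f hf).1 h0
    rw [evTorus_sub_eq_zero h hv hv₁ hv₂ ha hb (e₁.trans ev.symm) (e₂.trans ev.symm)] at hu
    exact not_isUnit_zero hu

/-- The generator is the image of the area cocycle of the torus under the connecting map. -/
theorem exists_generator_three [Nontrivial k] (h : (r * u - s * t) ^ 2 = 1) :
    ∃ x : H k Γ 3, Submodule.span k {x} = ⊤ ∧ x ≠ 0 := by
  obtain ⟨φ₁, h₁, φ₂, h₂, ha, hb, e⟩ := exists_split h (areaCocycle_mem (k := k) h)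
  have e' : hcobd φ₁ = hcobd φ₂ := by
    rw [← sub_eq_zero, ← map_sub, e, hcobd_areaCocycle]
  obtain ⟨f, hf⟩ := exists_homog (hcobd_mem_top h₁ ha hb e')
  have df : cobd f = 0 := by rw [← hcobd_homog_eq_zero, hf, hcobd_hcobd]
  exact ⟨cls f df, span_cls_three h df h₁ h₂ ha hb hf.symm (e'.symm.trans hf.symm)
    (by rw [e, evTorus_areaCocycle]; exact isUnit_one)⟩

/-! ### The sapphire group in degree two -/

theorem exists_primitives_two (h : (r * u - s * t) ^ 2 = 1)
    {z : HCochain k Γ 3} (hz : z ∈ invariants k (⊤ : Subgroup Γ) 3)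
    (dz : hcobd z = 0) :
    ∃ v₁ ∈ invariants k T 2, ∃ v₂ ∈ invariants k T 2, leftTranslate ga v₁ = v₁ ∧
      leftTranslate gb v₂ = v₂ ∧ hcobd v₁ = z ∧ hcobd v₂ = z := by
  obtain ⟨hT, ha, hb⟩ := mem_invariants_top.1 hz
  obtain ⟨v, hv, rfl⟩ := exists_primitive_two h hT dz
    (evTorus_eq_zero h (evTorus_translate_gA h) hT dz ha)
  exact exists_primitives h hv hz

/-- Primitives on the two Klein bottle groups may be changed by cocycles `F₁` and `F₂` before being
glued, and cocycles of degree one on the torus only matter through their values on `a₁²` and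
`b₁`. -/
theorem exists_invariant_primitive_two (h : (r * u - s * t) ^ 2 = 1) {v₁ v₂ F₁ F₂ : HCochain k Γ 2}
    (hv₁ : v₁ ∈ invariants k T 2)
    (hv₂ : v₂ ∈ invariants k T 2) (ha : leftTranslate ga v₁ = v₁) (hb : leftTranslate gb v₂ = v₂)
    (e : hcobd v₁ = hcobd v₂) (hF₁ : F₁ ∈ invariants k T 2) (hF₂ : F₂ ∈ invariants k T 2)
    (ha' : leftTranslate ga F₁ = F₁) (hb' : leftTranslate gb F₂ = F₂)
    (d₁ : hcobd F₁ = 0) (d₂ : hcobd F₂ = 0)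
    (ex : (v₁ - v₂) ![1, gx] = (F₁ - F₂) ![1, gx]) (ey : (v₁ - v₂) ![1, gy] = (F₁ - F₂) ![1, gy]) :
    ∃ v ∈ invariants k (⊤ : Subgroup Γ) 2, hcobd v = hcobd v₁ := by
  obtain ⟨w, hw, ew⟩ := exists_primitive_one (F := (v₁ - v₂) - (F₁ - F₂))
    (sub_mem (sub_mem hv₁ hv₂) (sub_mem hF₁ hF₂))
    (by rw [map_sub, map_sub, map_sub, e, d₁, d₂, sub_self, sub_self, sub_self])
    (by rw [Pi.sub_apply, ex, sub_self]) (by rw [Pi.sub_apply, ey, sub_self])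
  obtain ⟨v, hv, ev⟩ := exists_invariant_primitive h (v₁ := v₁ - F₁) (v₂ := v₂ - F₂)
    (sub_mem hv₁ hF₁) (by rw [map_sub, ha, ha']) (by rw [map_sub, hb, hb']) hw
    (by rw [ew]; abel)
  exact ⟨v, hv, by rw [ev, map_sub, d₁, sub_zero]⟩

theorem diff_coordX_gX (h : (r * u - s * t) ^ 2 = 1) :
    diff (coordX h k) ![1, gx] = 1 :=
  diff_apply_gX (coordX_gX_mul h k)

theorem diff_coordX_gY (h : (r * u - s * t) ^ 2 = 1) :
    diff (coordX h k) ![1, gy] = 0 :=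
  diff_apply_gY (coordX_gY_mul' h)

theorem diff_coordY_gX (h : (r * u - s * t) ^ 2 = 1) :
    diff (coordY h k) ![1, gx] = 0 :=
  diff_apply_gX (coordY_gX_mul' h)

theorem diff_coordY_gY (h : (r * u - s * t) ^ 2 = 1) :
    diff (coordY h k) ![1, gy] = 1 :=
  diff_apply_gY (coordY_gY_mul h k)

theorem acyclic_top_two (h : (r * u - s * t) ^ 2 = 1) (ht : IsUnit (t : k)) :
    Acyclic k (⊤ : Subgroup Γ) 2 := by
  intro z hz dz
  obtain ⟨v₁, hv₁, v₂, hv₂, ha, hb, rfl, e₂⟩ := exists_primitives_two h hz dz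
  obtain ⟨c, hc⟩ := ht.exists_right_inv
  let p := (v₁ - v₂) ![1, gx]
  let q := (v₁ - v₂) ![1, gy]
  -- `X` and `u X - t Y` span the cocycles on the torus: solve for the coefficients of `(p, q)`.
  refine exists_invariant_primitive_two h
    (F₁ := (p + c * q * u) • diff (coordX h k))
    (F₂ := (c * q) • ((u : k) • diff (coordX h k) - (t : k) • diff (coordY h k)))
    hv₁ hv₂ ha hb e₂.symm (Submodule.smul_mem _ _ (diff_coordX_mem h))
    (Submodule.smul_mem _ _ (sub_mem (Submodule.smul_mem _ _ (diff_coordX_mem h))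
      (Submodule.smul_mem _ _ (diff_coordY_mem h)))) ?_ ?_ ?_ ?_ ?_ ?_
  · rw [map_smul, leftTranslate_gA_diff]
  · rw [map_smul, leftTranslate_gB_diff]
  · rw [map_smul, hcobd_diff, smul_zero]
  · rw [map_smul, map_sub, map_smul, map_smul, hcobd_diff, hcobd_diff]
    simp
  · simp only [Pi.sub_apply, Pi.smul_apply, smul_eq_mul, diff_coordX_gX, diff_coordY_gX, p]
    ring
  · simp only [Pi.sub_apply, Pi.smul_apply, smul_eq_mul, diff_coordX_gY, diff_coordY_gY, q]
    linear_combination -(v₁ ![1, gy] - v₂ ![1, gy]) * hc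

/-! ### The sapphire group in degree one -/

theorem exists_invariant_primitive_one (h : (r * u - s * t) ^ 2 = 1) {F : HCochain k Γ 2}
    (hF : F ∈ invariants k (⊤ : Subgroup Γ) 2) (dF : hcobd F = 0) (ex : F ![1, gx] = 0)
    (ey : F ![1, gy] = 0) : ∃ v ∈ invariants k (⊤ : Subgroup Γ) 1, hcobd v = F := by
  obtain ⟨v, hv, rfl⟩ := exists_primitive_one (invariants_anti le_top hF) dF ex ey
  obtain ⟨v₁, hv₁, v₂, hv₂, ha, hb, e₁, e₂⟩ := exists_primitives h hv hF
  obtain ⟨w, -, ew⟩ := acyclic_bot 0 (v₁ - v₂) (invariants_anti bot_le (sub_mem hv₁ hv₂))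
    (by rw [map_sub, e₁, e₂, sub_self])
  -- The difference of the primitives is constant, so both are invariant under the whole group.
  have hc : leftTranslate gb (v₁ - v₂) = v₁ - v₂ := by
    rw [← ew, ← hcobd_translate, leftTranslate_eq (mem_invariants_zero (S := ⊤) w)
      (Subgroup.mem_top _)]
  refine ⟨v₁, mem_invariants_top.2 ⟨hv₁, ha, ?_⟩, e₁⟩
  rw [map_sub, hb] at hc
  exact sub_left_injective hc

/-- Invariant cocycles vanish on `b₁`, which `a₁` conjugates to its inverse. -/
theorem apply_gY_eq_zero {F : HCochain k Γ 2}
    (hF : F ∈ invariants k (⊤ : Subgroup Γ) 2) (dF : hcobd F = 0) : F ![1, gy] = 0 :=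
  apply_one_eq_zero dF (leftTranslate_eq hF (Subgroup.mem_top ga))
    (leftTranslate_eq hF (Subgroup.mem_top gy)) rel_one

theorem acyclic_top_one (h : (r * u - s * t) ^ 2 = 1) (ht : IsUnit (t : k)) :
    Acyclic k (⊤ : Subgroup Γ) 1 := by
  intro F hF dF
  have ey := apply_gY_eq_zero hF dF
  refine exists_invariant_primitive_one h hF dF ?_ ey
  have hm := fun g : Γ => leftTranslate_eq hF (Subgroup.mem_top g)
  have e := apply_one_eq_zero dF (hm gb) (hm _) rel_three
  rw [apply_one_mul dF (hm _), apply_one_zpow dF (hm _), apply_one_zpow dF (hm _), ey, mul_zero,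
    add_zero] at e
  exact (ht.mul_right_eq_zero).1 e

/-! ### Generators and their product when `t` vanishes in the coefficients -/

/-- If `t` vanishes in `k`, then `X` is changed by a constant under `a₂`. -/
theorem leftTranslate_gB_diff_coordX (h : (r * u - s * t) ^ 2 = 1) (ht : (t : k) = 0) :
    leftTranslate gb (diff (coordX h k)) = diff (coordX h k) ∧
    ∀ {n : ℕ} (F : HCochain k Γ (n + 1)), leftTranslate gb (mulDiff (coordX h k) F) =
      mulDiff (coordX h k) (leftTranslate gb F) := by
  have hk : ((r : k) * u - s * t) ^ 2 = 1 := by exact_mod_cast congrArg (Int.cast : ℤ → k) h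
  have e : ∀ g : Γ, coordX h k (gb * g) = coordX h k g + ⅟2 * r := fun g => by
    rw [coordX_gB_mul, reflFst]
    rw [ht] at hk ⊢
    linear_combination coordX h k g * hk
  exact ⟨leftTranslate_diff e, fun F => leftTranslate_mulDiff e F⟩

/-- If `t` vanishes in `k`, there are generators in degrees one and two whose product is a nonzero
generator in degree three. -/
theorem exists_generators [Nontrivial k] (h : (r * u - s * t) ^ 2 = 1) (ht : (t : k) = 0) :
    ∃ (α : H k Γ 1) (β : H k Γ 2), Submodule.span k {α} = ⊤ ∧ Submodule.span k {β} = ⊤ ∧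
      Submodule.span k {(cup α β : H k Γ 3)} = ⊤ ∧ (cup α β : H k Γ 3) ≠ 0 := by
  obtain ⟨hX, hX'⟩ := leftTranslate_gB_diff_coordX (k := k) h ht
  obtain ⟨f, hf⟩ := exists_homog (mem_invariants_top.2 ⟨diff_coordX_mem (k := k) h,
    leftTranslate_gA_diff h, hX⟩)
  have df : cobd f = 0 := by rw [← hcobd_homog_eq_zero, hf, hcobd_diff]
  obtain ⟨φ₁, h₁, φ₂, h₂, ha, hb, e⟩ := exists_split h (diff_coordY_mem (k := k) h)
  have e' : hcobd φ₁ = hcobd φ₂ := by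
    rw [← sub_eq_zero, ← map_sub, e, hcobd_diff]
  obtain ⟨f', hf'⟩ := exists_homog (hcobd_mem_top h₁ ha hb e')
  have df' : cobd f' = 0 := by rw [← hcobd_homog_eq_zero, hf', hcobd_hcobd]
  refine ⟨cls f df, cls f' df', ?_, ?_, ?_⟩
  · refine span_cls_eq_top df fun z hz dz => ⟨z ![1, gx], ?_⟩
    refine exists_invariant_primitive_one h
      (sub_mem hz (Submodule.smul_mem _ _ (homog_mem f))) ?_ ?_ ?_
    · rw [map_sub, dz, map_smul, hf, hcobd_diff, smul_zero, sub_zero]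
    · rw [hf, Pi.sub_apply, Pi.smul_apply, diff_coordX_gX, smul_eq_mul, mul_one, sub_self]
    · rw [hf, Pi.sub_apply, Pi.smul_apply, diff_coordX_gY, smul_zero, sub_zero,
        apply_gY_eq_zero hz dz]
  · refine span_cls_eq_top df' fun z hz dz => ?_
    obtain ⟨v₁, hv₁, v₂, hv₂, ha', hb', rfl, e₂⟩ := exists_primitives_two h hz dz
    let p := (v₁ - v₂) ![1, gx]
    let q := (v₁ - v₂) ![1, gy]
    have eφ : ∀ γ, φ₁ γ - φ₂ γ = diff (coordY h k) γ := fun γ => congrFun e γ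
    have hX0 : leftTranslate gb (0 : HCochain k Γ 2) = 0 := map_zero _
    obtain ⟨v, hv, ev⟩ := exists_invariant_primitive_two h (v₁ := v₁ - q • φ₁) (v₂ := v₂ - q • φ₂)
      (F₁ := p • diff (coordX h k)) (F₂ := 0)
      (sub_mem hv₁ (Submodule.smul_mem _ _ h₁)) (sub_mem hv₂ (Submodule.smul_mem _ _ h₂))
      (by rw [map_sub, map_smul, ha, ha']) (by rw [map_sub, map_smul, hb, hb'])
      (by rw [map_sub, map_sub, map_smul, map_smul, e', e₂])
      (Submodule.smul_mem _ _ (diff_coordX_mem h)) (zero_mem _)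
      (by rw [map_smul, leftTranslate_gA_diff]) hX0
      (by rw [map_smul, hcobd_diff, smul_zero]) (map_zero _)
      (by
        have := eφ ![1, gx]
        rw [diff_coordY_gX] at this
        simp only [Pi.sub_apply, Pi.smul_apply, smul_eq_mul, diff_coordX_gX, p, Pi.zero_apply]
        linear_combination -q * this)
      (by
        have := eφ ![1, gy]
        rw [diff_coordY_gY] at this
        simp only [Pi.sub_apply, Pi.smul_apply, smul_eq_mul, diff_coordX_gY, q, Pi.zero_apply]
        linear_combination -(v₁ ![1, gy] - v₂ ![1, gy]) * this)
    exact ⟨q, v, hv, by rw [ev, map_sub, map_smul, hf']⟩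
  · rw [cup_cls]
    have key : (homog (cochainCup f f') : HCochain k Γ 4) = mulDiff (coordX h k) (hcobd φ₁) := by
      rw [← hf']
      funext γ
      have e1 := congrFun hf ![γ 0, γ 1]
      change _ = (coordX h k (γ 1) - coordX h k (γ 0)) * _
      change _ = coordX h k (γ 1) - coordX h k (γ 0) at e1
      rw [← e1]
      unfold homog cochainCup
      congr 2
      · funext i
        fin_cases i
        rfl
      · funext i
        fin_cases i <;> rfl
    refine span_cls_three h _ (v₁ := -mulDiff (coordX h k) φ₁) (v₂ := -mulDiff (coordX h k) φ₂)
      (neg_mem (mulDiff_mem (coordX_gX_mul h k) (coordX_gY_mul' h) h₁))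
      (neg_mem (mulDiff_mem (coordX_gX_mul h k) (coordX_gY_mul' h) h₂)) ?_ ?_ ?_ ?_ ?_
    · rw [map_neg, leftTranslate_mulDiff (coordX_gA_mul h k), ha]
    · rw [map_neg, hX', hb]
    · rw [map_neg, hcobd_mulDiff, neg_neg]
      exact key.symm
    · rw [map_neg, hcobd_mulDiff, neg_neg, ← e']
      exact key.symm
    · have e3 : -mulDiff (coordX h k) φ₁ - -mulDiff (coordX h k) φ₂ =
          (-1 : k) • areaCocycle k h := by
        rw [areaCocycle, ← e]
        funext γ
        simp only [mulDiff, Pi.sub_apply, Pi.neg_apply, Pi.smul_apply, smul_eq_mul]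
        ring
      rw [e3, evTorus_smul, evTorus_areaCocycle, mul_one]
      exact isUnit_one.neg

end Gluing

end Sapphire

namespace GroupCohomologyRing

/-! ### The cohomology ring -/

open MvPolynomial

/-- The ideal `(α², β²)` of the polynomial ring. -/
abbrev squares (k : Type) [Field k] : Ideal (MvPolynomial (Fin 2) k) :=
  Ideal.span {(X 0 ^ 2 : MvPolynomial (Fin 2) k), X 1 ^ 2}

theorem mk_X_mul_mk_X {k : Type} [Field k] (i : Fin 2) :
    Ideal.Quotient.mk (squares k) (X i) * Ideal.Quotient.mk (squares k) (X i) = 0 := by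
  rw [← map_mul, ← pow_two, Ideal.Quotient.eq_zero_iff_mem]
  fin_cases i
  · exact Ideal.subset_span (Or.inl rfl)
  · exact Ideal.subset_span (Or.inr rfl)

theorem exists_eq_quotient {k : Type} [Field k] (q : MvPolynomial (Fin 2) k ⧸ squares k) :
    ∃ c₀ c₁ c₂ c₃ : k, q = algebraMap k _ c₀ + c₁ • Ideal.Quotient.mk _ (X 0) +
      c₂ • Ideal.Quotient.mk _ (X 1) +
      c₃ • (Ideal.Quotient.mk _ (X 0) * Ideal.Quotient.mk _ (X 1)) := by
  obtain ⟨p, rfl⟩ := Ideal.Quotient.mk_surjective q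
  induction p using MvPolynomial.induction_on with
  | C c => exact ⟨c, 0, 0, 0, by simp; rfl⟩
  | add p q hp hq =>
    obtain ⟨c₀, c₁, c₂, c₃, h⟩ := hp
    obtain ⟨d₀, d₁, d₂, d₃, h'⟩ := hq
    refine ⟨c₀ + d₀, c₁ + d₁, c₂ + d₂, c₃ + d₃, ?_⟩
    rw [map_add, h, h']
    simp only [map_add, add_smul]
    abel
  | mul_X p i hp =>
    obtain ⟨c₀, c₁, c₂, c₃, h⟩ := hp
    have h0 := mk_X_mul_mk_X (k := k) 0
    have h1 := mk_X_mul_mk_X (k := k) 1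
    rw [map_mul, h]
    have hs : ∀ (c : k) (x : MvPolynomial (Fin 2) k ⧸ squares k),
        c • x = algebraMap k _ c * x := fun c x => Algebra.smul_def c x
    simp only [hs]
    fin_cases i
    · refine ⟨0, c₀, 0, c₂, ?_⟩
      simp only [map_zero, Fin.zero_eta]
      linear_combination (algebraMap k _ c₁ + algebraMap k _ c₃ * Ideal.Quotient.mk _ (X 1)) * h0
    · refine ⟨0, 0, c₀, c₁, ?_⟩
      simp only [map_zero, Fin.mk_one]
      linear_combination (algebraMap k _ c₂ + algebraMap k _ c₃ * Ideal.Quotient.mk _ (X 0)) * h1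

/-- An algebra with basis `1, a, b, a b`, where `a` and `b` commute and have square zero, is
`k[α, β] / (α², β²)`. -/
theorem exists_algEquiv_of_basis {k A : Type} [Field k] [Ring A] [Algebra k A] {a b : A}
    (haa : a * a = 0) (hbb : b * b = 0) (hba : b * a = a * b)
    (hspan : ∀ x : A, ∃ c₀ c₁ c₂ c₃ : k, x = algebraMap k A c₀ + c₁ • a + c₂ • b + c₃ • (a * b))
    (hind : ∀ c₀ c₁ c₂ c₃ : k, algebraMap k A c₀ + c₁ • a + c₂ • b + c₃ • (a * b) = 0 →
      c₀ = 0 ∧ c₁ = 0 ∧ c₂ = 0 ∧ c₃ = 0) :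
    ∃ e : A ≃ₐ[k] (MvPolynomial (Fin 2) k ⧸ squares k),
      e a = Ideal.Quotient.mk _ (X 0) ∧ e b = Ideal.Quotient.mk _ (X 1) := by
  have hxa : ∀ x : A, Commute x a := fun x => by
    obtain ⟨c₀, c₁, c₂, c₃, rfl⟩ := hspan x
    have hb : Commute b a := hba
    exact (((Algebra.commute_algebraMap_left c₀ a).add_left
      ((Commute.refl a).smul_left c₁)).add_left (hb.smul_left c₂)).add_left
        (((Commute.refl a).mul_left hb).smul_left c₃)
  have hxb : ∀ x : A, Commute x b := fun x => by
    obtain ⟨c₀, c₁, c₂, c₃, rfl⟩ := hspan x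
    have hb : Commute a b := hba.symm
    exact (((Algebra.commute_algebraMap_left c₀ b).add_left (hb.smul_left c₁)).add_left
      ((Commute.refl b).smul_left c₂)).add_left ((hb.mul_left (Commute.refl b)).smul_left c₃)
  have hcomm : ∀ x y : A, x * y = y * x := fun x y => by
    obtain ⟨c₀, c₁, c₂, c₃, rfl⟩ := hspan y
    exact ((((Algebra.commute_algebraMap_right c₀ x).add_right
      ((hxa x).smul_right c₁)).add_right ((hxb x).smul_right c₂)).add_right
      (((hxa x).mul_right (hxb x)).smul_right c₃)).eq
  let _ : CommRing A := { ‹Ring A› with mul_comm := hcomm }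
  let φ : (MvPolynomial (Fin 2) k ⧸ squares k) →ₐ[k] A :=
    Ideal.Quotient.liftₐ (squares k) (aeval ![a, b]) (by
      intro p hp
      have hle : squares k ≤ RingHom.ker (aeval (R := k) ![a, b]) := by
        rw [Ideal.span_le]
        rintro p (rfl | rfl)
        · simpa [RingHom.mem_ker, pow_two] using haa
        · simpa [RingHom.mem_ker, pow_two] using hbb
      exact hle hp)
  have hφ0 : φ (Ideal.Quotient.mk _ (X 0)) = a := aeval_X (R := k) ![a, b] 0
  have hφ1 : φ (Ideal.Quotient.mk _ (X 1)) = b := aeval_X (R := k) ![a, b] 1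
  have hφ : Function.Bijective φ := by
    constructor
    · rw [injective_iff_map_eq_zero]
      intro q hq
      obtain ⟨c₀, c₁, c₂, c₃, rfl⟩ := exists_eq_quotient q
      rw [map_add, map_add, map_add, map_smul, map_smul, map_smul, map_mul, hφ0, hφ1,
        AlgHom.commutes] at hq
      obtain ⟨rfl, rfl, rfl, rfl⟩ := hind _ _ _ _ hq
      simp
    · intro x
      obtain ⟨c₀, c₁, c₂, c₃, rfl⟩ := hspan x
      refine ⟨algebraMap k _ c₀ + c₁ • Ideal.Quotient.mk _ (X 0) +
        c₂ • Ideal.Quotient.mk _ (X 1) +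
        c₃ • (Ideal.Quotient.mk _ (X 0) * Ideal.Quotient.mk _ (X 1)), ?_⟩
      rw [map_add, map_add, map_add, map_smul, map_smul, map_smul, map_mul, hφ0, hφ1,
        AlgHom.commutes]
  refine ⟨(AlgEquiv.ofBijective φ hφ).symm, ?_, ?_⟩
  · rw [AlgEquiv.symm_apply_eq]
    exact hφ0.symm
  · rw [AlgEquiv.symm_apply_eq]
    exact hφ1.symm

variable {k G : Type} [Field k] [Group G]

theorem span_unit : Submodule.span k {unit k G} = ⊤ := by
  refine eq_top_iff.2 fun x _ => ?_
  obtain ⟨f, hf, rfl⟩ := exists_cls x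
  refine Submodule.mem_span_singleton.2 ⟨f Fin.elim0, ?_⟩
  rw [unit, ← cls_smul _ _ _ (cobd_smul _ cobd_one)]
  refine cls_congr (funext fun g => ?_) _ _
  rw [Subsingleton.elim g Fin.elim0]
  simp

theorem unit_ne_zero : unit k G ≠ 0 := by
  intro h
  rcases (cls_eq_zero_iff _ _).1 h with h | ⟨i, _, hi, _⟩
  · exact one_ne_zero (congrFun h Fin.elim0)
  · omega

theorem incl_smul {n : ℕ} (c : k) (x : H k G n) : incl (c • x) = c • incl x :=
  (DirectSum.lof k ℕ (H k G) n).map_smul c x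

theorem algebraMap_eq_incl (c : k) : algebraMap k (CohomologyRing k G) c = incl (c • unit k G) :=
  rfl

theorem ne_zero_of_cup_left {m n : ℕ} {x : H k G m} {y : H k G n} (h : cup x y ≠ 0) : x ≠ 0 := by
  rintro rfl
  refine h ?_
  have := cup_smul_left (0 : k) (0 : H k G m) y
  rwa [zero_smul, zero_smul] at this

theorem ne_zero_of_cup_right {m n : ℕ} {x : H k G m} {y : H k G n} (h : cup x y ≠ 0) :
    y ≠ 0 := by
  rintro rfl
  refine h ?_
  have := cup_smul_right (0 : k) x (0 : H k G n)
  rwa [zero_smul, zero_smul] at this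

/-- If the cohomology has the basis `1, α, β, α ⌣ β`, where `α` and `β` are of degree one and two,
then it is the algebra `k[α, β] / (α², β²)`. -/
theorem exists_algEquiv [Invertible (2 : k)] {α : H k G 1} {β : H k G 2}
    (hα : Submodule.span k {α} = ⊤) (hβ : Submodule.span k {β} = ⊤)
    (hαβ : Submodule.span k {(cup α β : H k G 3)} = ⊤) (hne : (cup α β : H k G 3) ≠ 0)
    (h4 : ∀ n, 4 ≤ n → Subsingleton (H k G n)) :
    ∃ e : CohomologyRing k G ≃ₐ[k] (MvPolynomial (Fin 2) k ⧸ squares k),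
      e (incl α) = Ideal.Quotient.mk _ (X 0) ∧ e (incl β) = Ideal.Quotient.mk _ (X 1) := by
  have hα0 := ne_zero_of_cup_left hne
  have hβ0 := ne_zero_of_cup_right hne
  have hab : incl α * incl β = incl (cup α β : H k G 3) := incl_mul_incl α β
  refine exists_algEquiv_of_basis ?_ ?_ ?_ ?_ ?_
  · rw [incl_mul_incl, cup_self_one]
    exact map_zero _
  · have := h4 4 le_rfl
    have h0 : (cup β β : H k G 4) = 0 := Subsingleton.elim _ _
    exact (incl_mul_incl β β).trans ((congrArg (incl (n := 4)) h0).trans (map_zero _))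
  · rw [hab, ← cup_comm_one_two]
    exact incl_mul_incl β α
  · intro x
    simp only [hab, algebraMap_eq_incl]
    induction x using DirectSum.induction_on with
    | zero => exact ⟨0, 0, 0, 0, by simp⟩
    | of n x =>
      match n, x with
      | 0, x =>
        obtain ⟨c, rfl⟩ :=
          Submodule.mem_span_singleton.1 (span_unit.ge (Submodule.mem_top (x := x)))
        exact ⟨c, 0, 0, 0, by simp⟩
      | 1, x =>
        obtain ⟨c, rfl⟩ := Submodule.mem_span_singleton.1 (hα.ge (Submodule.mem_top (x := x)))
        exact ⟨0, c, 0, 0, by simp [incl_smul]⟩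
      | 2, x =>
        obtain ⟨c, rfl⟩ := Submodule.mem_span_singleton.1 (hβ.ge (Submodule.mem_top (x := x)))
        exact ⟨0, 0, c, 0, by simp [incl_smul]⟩
      | 3, x =>
        obtain ⟨c, rfl⟩ := Submodule.mem_span_singleton.1 (hαβ.ge (Submodule.mem_top (x := x)))
        exact ⟨0, 0, 0, c, by simp [incl_smul]⟩
      | n + 4, x =>
        have := h4 (n + 4) (by omega)
        rw [Subsingleton.elim x 0]
        exact ⟨0, 0, 0, 0, by simp⟩
    | add x y hx hy =>
      obtain ⟨c₀, c₁, c₂, c₃, rfl⟩ := hx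
      obtain ⟨d₀, d₁, d₂, d₃, rfl⟩ := hy
      refine ⟨c₀ + d₀, c₁ + d₁, c₂ + d₂, c₃ + d₃, ?_⟩
      simp only [map_add, add_smul]
      abel
  · intro c₀ c₁ c₂ c₃ h
    rw [hab, algebraMap_eq_incl, ← incl_smul, ← incl_smul, ← incl_smul] at h
    have h' : ∀ n, (incl (c₀ • unit k G) n + incl (c₁ • α) n + incl (c₂ • β) n +
      incl (c₃ • (cup α β : H k G 3)) n : H k G n) = 0 := fun n =>
        congrArg (fun x : CohomologyRing k G => x n) h
    have z : ∀ {i : ℕ} (j : ℕ) (x : H k G i), j ≠ i → (incl x : CohomologyRing k G) j = 0 :=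
      fun j x hij => DirectSum.of_eq_of_ne _ j x hij
    have e0 := h' 0
    have e1 := h' 1
    have e2 := h' 2
    have e3 := h' 3
    rw [DirectSum.of_eq_same, z 0 (c₁ • α) (by decide), z 0 (c₂ • β) (by decide),
      z 0 (c₃ • (cup α β : H k G 3)) (by decide), add_zero, add_zero, add_zero] at e0
    rw [DirectSum.of_eq_same, z 1 (c₀ • unit k G) (by decide), z 1 (c₂ • β) (by decide),
      z 1 (c₃ • (cup α β : H k G 3)) (by decide), add_zero, add_zero, zero_add] at e1
    rw [DirectSum.of_eq_same, z 2 (c₀ • unit k G) (by decide), z 2 (c₁ • α) (by decide),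
      z 2 (c₃ • (cup α β : H k G 3)) (by decide), add_zero, zero_add, zero_add] at e2
    rw [DirectSum.of_eq_same, z 3 (c₀ • unit k G) (by decide), z 3 (c₁ • α) (by decide),
      z 3 (c₂ • β) (by decide), zero_add, zero_add, zero_add] at e3
    exact ⟨(smul_eq_zero.1 e0).resolve_right unit_ne_zero, (smul_eq_zero.1 e1).resolve_right hα0,
      (smul_eq_zero.1 e2).resolve_right hβ0, (smul_eq_zero.1 e3).resolve_right hne⟩

end GroupCohomologyRing

end

theorem mainTheorem3 (r s t u : ℤ) (hr : r ≠ 0) (hs : s ≠ 0) (ht : t ≠ 0) (hu : u ≠ 0)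
    (hdet : r * u - s * t = 1 ∨ r * u - s * t = -1)
    (p : ℕ) [Fact p.Prime] (hp : Odd p) :
    Nonempty (GroupCohomologyRing.H (ZMod p) (Sapphire.SapphireGroup r s t u) 0 ≃ₗ[ZMod p] ZMod p) ∧
    ((p : ℤ) ∣ t →
      Nonempty (GroupCohomologyRing.H (ZMod p) (Sapphire.SapphireGroup r s t u) 1
        ≃ₗ[ZMod p] ZMod p) ∧
      Nonempty (GroupCohomologyRing.H (ZMod p) (Sapphire.SapphireGroup r s t u) 2
        ≃ₗ[ZMod p] ZMod p)) ∧
    (¬ (p : ℤ) ∣ t →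
      Subsingleton (GroupCohomologyRing.H (ZMod p) (Sapphire.SapphireGroup r s t u) 1) ∧
      Subsingleton (GroupCohomologyRing.H (ZMod p) (Sapphire.SapphireGroup r s t u) 2)) ∧
    Nonempty (GroupCohomologyRing.H (ZMod p) (Sapphire.SapphireGroup r s t u) 3 ≃ₗ[ZMod p] ZMod p) ∧
    (∀ n : ℕ, 4 ≤ n →
      Subsingleton (GroupCohomologyRing.H (ZMod p) (Sapphire.SapphireGroup r s t u) n)) ∧
    ((p : ℤ) ∣ t →
      ∃ (α : GroupCohomologyRing.H (ZMod p) (Sapphire.SapphireGroup r s t u) 1)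
        (β : GroupCohomologyRing.H (ZMod p) (Sapphire.SapphireGroup r s t u) 2),
        Submodule.span (ZMod p) {α} = ⊤ ∧
        Submodule.span (ZMod p) {β} = ⊤ ∧
        Submodule.span (ZMod p) {(GroupCohomologyRing.cup α β :
          GroupCohomologyRing.H (ZMod p) (Sapphire.SapphireGroup r s t u) 3)} = ⊤ ∧
        ∃ e : GroupCohomologyRing.CohomologyRing (ZMod p) (Sapphire.SapphireGroup r s t u)
            ≃ₐ[ZMod p]
            (MvPolynomial (Fin 2) (ZMod p) ⧸
              Ideal.span {(MvPolynomial.X 0 ^ 2 : MvPolynomial (Fin 2) (ZMod p)),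
                MvPolynomial.X 1 ^ 2}),
          e (GroupCohomologyRing.incl α) = Ideal.Quotient.mk _ (MvPolynomial.X 0) ∧
          e (GroupCohomologyRing.incl β) = Ideal.Quotient.mk _ (MvPolynomial.X 1)) := by
  classical
  have hdet' : (r * u - s * t) ^ 2 = 1 := by
    rcases hdet with h | h <;> rw [h] <;> norm_num
  have h2 : (2 : ZMod p) ≠ 0 := by
    intro h
    have h3 : p ∣ 2 := (ZMod.natCast_eq_zero_iff 2 p).1 (by exact_mod_cast h)
    have h4 := (Nat.prime_dvd_prime_iff_eq Fact.out Nat.prime_two).1 h3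
    rw [h4] at hp
    exact absurd hp (by decide)
  let _ := invertibleOfNonzero h2
  have ht0 : (p : ℤ) ∣ t ↔ (t : ZMod p) = 0 := (ZMod.intCast_zmod_eq_zero_iff_dvd t p).symm
  have h4 : ∀ n : ℕ, 4 ≤ n →
      Subsingleton (GroupCohomologyRing.H (ZMod p) (Sapphire.SapphireGroup r s t u) n) := by
    intro n hn
    obtain ⟨m, rfl⟩ := Nat.exists_eq_add_of_le' hn
    exact GroupCohomologyRing.subsingleton_H (Sapphire.acyclic_top hdet' m)
  refine ⟨GroupCohomologyRing.nonempty_linearEquiv GroupCohomologyRing.unit_ne_zero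
    GroupCohomologyRing.span_unit, fun h => ?_, fun h => ?_, ?_, h4, fun h => ?_⟩
  · obtain ⟨α, β, hα, hβ, -, hne⟩ := Sapphire.exists_generators hdet' (ht0.1 h)
    exact ⟨GroupCohomologyRing.nonempty_linearEquiv
        (GroupCohomologyRing.ne_zero_of_cup_left hne) hα,
      GroupCohomologyRing.nonempty_linearEquiv
        (GroupCohomologyRing.ne_zero_of_cup_right hne) hβ⟩
  · have hu : IsUnit (t : ZMod p) := isUnit_iff_ne_zero.2 fun h' => h (ht0.2 h')
    exact ⟨GroupCohomologyRing.subsingleton_H (Sapphire.acyclic_top_one hdet' hu),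
      GroupCohomologyRing.subsingleton_H (Sapphire.acyclic_top_two hdet' hu)⟩
  · obtain ⟨x, hx, hx0⟩ := Sapphire.exists_generator_three (k := ZMod p) hdet'
    exact GroupCohomologyRing.nonempty_linearEquiv hx0 hx
  · obtain ⟨α, β, hα, hβ, hαβ, hne⟩ := Sapphire.exists_generators hdet' (ht0.1 h)
    exact ⟨α, β, hα, hβ, hαβ, GroupCohomologyRing.exists_algEquiv hα hβ hαβ hne h4⟩
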